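/- Let $\mathbb{F}_q$ be a finite field with $q$ odd, let $\psi:\mathbb{F}_q\to\mathbb{C}^\times$ be a non-trivial additive character, let $\sigma$ be the quadratic character of $\mathbb{F}_q^\times$, and put $G_1=\sum_{z\in\mathbb{F}_q}\psi(\tfrac12 z^2)$. Let $\mathsf{Symp}$ be the groupoid of finite-dimensional symplectic vector spaces $(V,\omega)$ over $\mathbb{F}_q$ and linear symplectic isomorphisms, and let $\mathsf{Vect}$ be the category of finite-dimensional complex vector spaces. For $V\in\mathsf{Symp}$ of dimension $2n$, let $H(V)=V\times\mathbb{F}_q$ be the Heisenberg group, with $(v,z)(v',z')=(v+v',z+z'+\tfrac12\omega(v,v'))$ and center $\{(0,z)\}$. An oriented Lagrangian $L^\circ=(L,o_L)$ is a Lagrangian subspace $L\subset V$ with a non-zero vector $o_L\in\bigwedge^n L$; $\mathrm{Lag}^\circ(V)$ is the set of all of these. Let $\mathcal{H}_{L^\circ}$ be the space of functions $f:H(V)\to\mathbb{C}$ with $f(z\cdot h)=\psi(z)f(h)$ for $z$ central and $f(l\cdot h)=f(h)$ for $l\in L$, on which $H(V)$ acts by right translation $\pi_{L^\circ}$. For Lagrangians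 $L,M$ let $\omega_\wedge:\bigwedge^nL\otimes\bigwedge^nM\to\mathbb{F}_q$ be the pairing induced by $\omega$, normalized as $\omega_\wedge(l_1\wedge\dots\wedge l_n,\,m_1\wedge\dots\wedge m_n)=(-1)^{\binom n2}\det(\omega(l_i,m_j))$ (the value of the divided power $\omega^{n}/n!$ on $l_1\wedge\dots\wedge l_n\wedge m_1\wedge\dots\wedge m_n$). There is a unique system of linear maps $F_{M^\circ,L^\circ}:\mathcal{H}_{L^\circ}\to\mathcal{H}_{M^\circ}$, $(M^\circ,L^\circ)\in\mathrm{Lag}^\circ(V)^2$, which commute with the actions of $H(V)$, satisfy $F_{N^\circ,L^\circ}=F_{N^\circ,M^\circ}\circ F_{M^\circ,L^\circ}$ for all $N^\circ,M^\circ,L^\circ$, and are given, whenever $L\cap M=0$, by $$F_{M^\circ,L^\circ}[f](h)=(G_1/q)^n\,\sigma\!\left((-1)^{\binom n2}\omega_\wedge(o_L,o_M)\right)\sum_{m\in M}f(m\cdot h).$$ Let $\mathcal{H}(V)$ be the space of all families $(v_{L^\circ}\in\mathcal{H}_{L^\circ})_{L^\circ\in\mathrm{Lag}^\circ(V)}$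 with $F_{M^\circ,L^\circ}(v_{L^\circ})=v_{M^\circ}$ for all $(M^\circ,L^\circ)\in\mathrm{Lag}^\circ(V)^2$. Then $V\mapsto\mathcal{H}(V)$ is a contravariant functor $\mathsf{Symp}\to\mathsf{Vect}$: each $\mathcal{H}(V)$ is finite-dimensional, and for every symplectic isomorphism $f:V\to U$ the pullback $(\mathcal{H}(f)v)_{L^\circ}(h)=v_{f(L^\circ)}(f(h))$, where $f(v,z)=(f(v),z)$ on Heisenberg groups, maps $\mathcal{H}(U)$ to $\mathcal{H}(V)$ and respects identities and composition. In particular, for every $V$ the group $Sp(V)$ acts on $\mathcal{H}(V)$ by $\rho_V(g)=\mathcal{H}(g^{-1})$, and $\rho_V$ is a model of the Weil representation: the componentwise right translations $\pi_V$ of $H(V)$ preserve $\mathcal{H}(V)$ and make it an irreducible representation of $H(V)$ on which the center acts by $\psi$ (the Heisenberg representation), and $\rho_V(g)\,\pi_V(h)\,\rho_V(g)^{-1}=\pi_V(g\cdot h)$ for all $g\in Sp(V)$, $h\in H(V)$. -/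

import Mathlib

open CategoryTheory Opposite

universe u v

/-- A finite-dimensional symplectic vector space over `F`. -/
structure Symp (F : Type u) [Field F] where
  carrier : Type v
  [addCommGroup : AddCommGroup carrier]
  [module : Module F carrier]
  [finite : Module.Finite F carrier]
  /-- the symplectic form `ω` -/
  form : LinearMap.BilinForm F carrier
  isAlt : form.IsAlt
  nondegenerate : form.Nondegenerate

namespace Symp

attribute [instance] Symp.addCommGroup Symp.module Symp.finite

/-- A linear isomorphism of symplectic vector spaces. -/
@[ext]
structure Hom {F : Type u} [Field F] (V U : Symp.{u, v} F) where
  toEquiv : V.carrier ≃ₗ[F] U.carrier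
  map_form : ∀ x y, U.form (toEquiv x) (toEquiv y) = V.form x y

/-- The groupoid of symplectic vector spaces over `F`. -/
instance groupoid {F : Type u} [Field F] : Groupoid (Symp.{u, v} F) where
  Hom V U := Hom V U
  id V := ⟨LinearEquiv.refl F V.carrier, fun _ _ => rfl⟩
  comp f g := ⟨f.toEquiv.trans g.toEquiv, fun x y => by simp [g.map_form, f.map_form]⟩
  inv f := ⟨f.toEquiv.symm, fun x y => by rw [← f.map_form]; simp⟩
  comp_id f := Hom.ext (by ext; rfl)
  id_comp f := Hom.ext (by ext; rfl)
  assoc f g h := Hom.ext (by ext; rfl)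
  inv_comp f := Hom.ext (by ext x; exact f.toEquiv.apply_symm_apply x)
  comp_inv f := Hom.ext (by ext x; exact f.toEquiv.symm_apply_apply x)

/-- The underlying linear isomorphism of a morphism of symplectic spaces. -/
def equiv {F : Type u} [Field F] {V U : Symp.{u, v} F} (f : V ⟶ U) :
    V.carrier ≃ₗ[F] U.carrier :=
  Hom.toEquiv f

theorem form_equiv {F : Type u} [Field F] {V U : Symp.{u, v} F} (f : V ⟶ U) (x y : V.carrier) :
    U.form (equiv f x) (equiv f y) = V.form x y :=
  Hom.map_form f x y

/-- The number `n` with `dim V = 2n`. -/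
noncomputable def halfDim {F : Type u} [Field F] (V : Symp.{u, v} F) : ℕ :=
  Module.finrank F V.carrier / 2

theorem halfDim_eq {F : Type u} [Field F] {V U : Symp.{u, v} F} (f : V ⟶ U) :
    V.halfDim = U.halfDim := by
  rw [halfDim, halfDim, (equiv f).finrank_eq]

end Symp

/-- The Heisenberg group `H(V)`, with underlying set `V × F`. -/
@[ext]
structure Heis {F : Type u} [Field F] (V : Symp.{u, v} F) where
  vec : V.carrier
  cen : F

namespace Heis

variable {F : Type u} [Field F] {V U : Symp.{u, v} F}

/-- `(v, z) · (v', z') = (v + v', z + z' + ½ ω(v, v'))`. -/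
instance : Mul (Heis V) :=
  ⟨fun a b => ⟨a.vec + b.vec, a.cen + b.cen + (2 : F)⁻¹ * V.form a.vec b.vec⟩⟩

instance : One (Heis V) := ⟨⟨0, 0⟩⟩

instance : Inv (Heis V) := ⟨fun a => ⟨-a.vec, -a.cen⟩⟩

@[simp] theorem vec_mul (a b : Heis V) : (a * b).vec = a.vec + b.vec := rfl

@[simp] theorem cen_mul (a b : Heis V) :
    (a * b).cen = a.cen + b.cen + (2 : F)⁻¹ * V.form a.vec b.vec := rfl

@[simp] theorem vec_one : (1 : Heis V).vec = 0 := rfl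

@[simp] theorem cen_one : (1 : Heis V).cen = 0 := rfl

@[simp] theorem vec_inv (a : Heis V) : (a⁻¹).vec = -a.vec := rfl

@[simp] theorem cen_inv (a : Heis V) : (a⁻¹).cen = -a.cen := rfl

instance : Group (Heis V) :=
  Group.ofLeftAxioms
    (fun a b c => by
      ext
      · simp [add_assoc]
      · simp only [cen_mul, vec_mul, map_add, LinearMap.add_apply]
        ring)
    (fun a => by ext <;> simp)
    (fun a => by ext <;> simp [V.isAlt a.vec])

/-- The central element `(0, z)`. -/
def ofCenter (V : Symp.{u, v} F) (z : F) : Heis V := ⟨0, z⟩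

/-- The element `(v, 0)`; through it a subspace of `V` acts on `H(V)`. -/
def ofVec (x : V.carrier) : Heis V := ⟨x, 0⟩

/-- The group homomorphism `(v, z) ↦ (f v, z)` induced by a symplectic isomorphism `f`. -/
def map (f : V ⟶ U) : Heis V →* Heis U where
  toFun a := ⟨Symp.equiv f a.vec, a.cen⟩
  map_one' := by ext <;> simp
  map_mul' a b := by ext <;> simp [Symp.form_equiv]

theorem map_ofCenter (f : V ⟶ U) (z : F) : map f (ofCenter V z) = ofCenter U z := by
  ext <;> simp [map, ofCenter]

theorem map_ofVec (f : V ⟶ U) (x : V.carrier) :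
    map f (ofVec x) = ofVec (Symp.equiv f x) := rfl

end Heis

/-- An oriented Lagrangian subspace: a subspace `L` with `L = L^⊥`, together with a non-zero vector
of the top exterior power of `L` (`dim L = n` for `dim V = 2n`). -/
structure OrientedLagrangian {F : Type u} [Field F] (V : Symp.{u, v} F) where
  L : Submodule F V.carrier
  orthogonal_eq : V.form.orthogonal L = L
  orientation : ExteriorAlgebra F L
  orientation_mem : orientation ∈ ⋀[F]^(V.halfDim) L
  orientation_ne : orientation ≠ 0

namespace OrientedLagrangian

variable {F : Type u} [Field F] {V U : Symp.{u, v} F}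

/-- The orientation as an element of the top exterior power. -/
def o (A : OrientedLagrangian V) : ⋀[F]^(V.halfDim) A.L :=
  ⟨A.orientation, A.orientation_mem⟩

/-- The image `f(L°)` of an oriented Lagrangian under a symplectic isomorphism `f`. -/
noncomputable def map (f : V ⟶ U) (A : OrientedLagrangian V) : OrientedLagrangian U where
  L := A.L.map (Symp.equiv f : V.carrier →ₗ[F] U.carrier)
  orthogonal_eq := by
    ext y
    have key : ∀ x : V.carrier, x ∈ A.L ↔ ∀ l ∈ A.L, V.form l x = 0 := fun x => by
      conv_lhs => rw [← A.orthogonal_eq]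
      exact LinearMap.BilinForm.mem_orthogonal_iff
    obtain ⟨x, rfl⟩ := (Symp.equiv f).surjective y
    have e : Symp.equiv f x ∈ A.L.map (Symp.equiv f : V.carrier →ₗ[F] U.carrier) ↔ x ∈ A.L := by
      simp
    rw [e, key, LinearMap.BilinForm.mem_orthogonal_iff]
    constructor
    · intro h l hl
      exact (Symp.form_equiv f l x).symm.trans (h (Symp.equiv f l) ⟨l, hl, rfl⟩)
    · rintro h _ ⟨l, hl, rfl⟩
      exact (Symp.form_equiv f l x).trans (h l hl)
  orientation :=
    ExteriorAlgebra.map ((Symp.equiv f).submoduleMap A.L).toLinearMap A.orientation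
  orientation_mem := by
    have h := Submodule.mem_map_of_mem
      (f := (ExteriorAlgebra.map ((Symp.equiv f).submoduleMap A.L).toLinearMap).toLinearMap)
      A.orientation_mem
    rw [← Symp.halfDim_eq f]
    refine SetLike.le_def.mp ?_ h
    rw [Submodule.map_pow]
    refine pow_le_pow_left' ?_ _
    rintro _ ⟨_, ⟨x, rfl⟩, rfl⟩
    exact ⟨_, (ExteriorAlgebra.map_apply_ι _ x).symm⟩
  orientation_ne := by
    have hinj : Function.Injective
        (ExteriorAlgebra.map ((Symp.equiv f).submoduleMap A.L).toLinearMap) := by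
      exact ExteriorAlgebra.map_injective_field (by
        exact LinearMap.ker_eq_bot.mpr ((Symp.equiv f).submoduleMap A.L).injective)
    exact fun h => A.orientation_ne (hinj (h.trans (map_zero _).symm))

end OrientedLagrangian

/-- The pairing `ω_∧ : ⋀ⁿ L × ⋀ⁿ M → F` induced by `ω`, where `dim V = 2n`. It is the pairing
`(a, b) ↦ (ωⁿ / n!)(a ∧ b)`, where `ωⁿ / n!` is the divided power (the Pfaffian); since `L` and `M`
are isotropic, this is the contraction of adjacent factors,
`ω_∧(l₁ ∧ ⋯ ∧ lₙ, m₁ ∧ ⋯ ∧ mₙ) = det (ω(lₙ₊₁₋ᵢ, mⱼ)) = (-1)^(n(n-1)/2) det (ω(lᵢ, mⱼ))`. -/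
noncomputable def omegaWedge {F : Type u} [Field F] {V : Symp.{u, v} F}
    (A B : OrientedLagrangian V) :
    ⋀[F]^(V.halfDim) A.L →ₗ[F] ⋀[F]^(V.halfDim) B.L →ₗ[F] F :=
  (-1 : F) ^ (V.halfDim.choose 2) •
    (exteriorPower.pairingDual F B.L V.halfDim ∘ₗ
      exteriorPower.map V.halfDim (V.form.domRestrict₁₂ A.L B.L))

theorem omegaWedge_ιMulti {F : Type u} [Field F] {V : Symp.{u, v} F}
    (A B : OrientedLagrangian V) (l : Fin V.halfDim → A.L) (m : Fin V.halfDim → B.L) :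
    omegaWedge A B (exteriorPower.ιMulti F _ l) (exteriorPower.ιMulti F _ m) =
      (-1 : F) ^ (V.halfDim.choose 2) *
        (Matrix.of fun i j => V.form (l i : V.carrier) (m j)).det := by
  rw [← Matrix.det_transpose (Matrix.of _)]
  simp only [omegaWedge, LinearMap.smul_apply, LinearMap.comp_apply,
    exteriorPower.map_apply_ιMulti, exteriorPower.pairingDual_ιMulti_ιMulti, smul_eq_mul]
  rfl

/-- The model `𝓗_L`: functions `f` on the Heisenberg group with `f(z · h) = ψ(z) f(h)` for central
`z` and `f(l · h) = f(h)` for `l ∈ L`. -/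
def modelSpace {F : Type u} [Field F] {V : Symp.{u, v} F} (ψ : AddChar F ℂ)
    (A : OrientedLagrangian V) : Submodule ℂ (Heis V → ℂ) where
  carrier := {f | (∀ z h, f (Heis.ofCenter V z * h) = ψ z * f h) ∧
    ∀ l ∈ A.L, ∀ h, f (Heis.ofVec l * h) = f h}
  zero_mem' := by simp
  add_mem' := by
    rintro f g ⟨hf, hf'⟩ ⟨hg, hg'⟩
    refine ⟨fun z h => ?_, fun l hl h => ?_⟩
    · simp [hf, hg, mul_add]
    · simp [hf' l hl, hg' l hl]
  smul_mem' := by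
    rintro c f ⟨hf, hf'⟩
    refine ⟨fun z h => ?_, fun l hl h => ?_⟩
    · simp [hf, mul_left_comm]
    · simp [hf' l hl]

/-- The Heisenberg action on `𝓗_L` by right translation, `(π_L(h) f)(h') = f(h' · h)`. -/
def modelRep {F : Type u} [Field F] {V : Symp.{u, v} F} (ψ : AddChar F ℂ)
    (A : OrientedLagrangian V) : Representation ℂ (Heis V) (modelSpace ψ A) where
  toFun h :=
    { toFun := fun f => ⟨fun h' => f.1 (h' * h),
        fun z h' => by simpa only [mul_assoc] using f.2.1 z (h' * h),
        fun l hl h' => by simpa only [mul_assoc] using f.2.2 l hl (h' * h)⟩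
      map_add' := fun _ _ => rfl
      map_smul' := fun _ _ => rfl }
  map_one' := by
    ext f h'
    simp
  map_mul' a b := by
    ext f h'
    simp [mul_assoc]

/-- A family of linear maps `F_{M°,L°} : 𝓗_{L°} → 𝓗_{M°}`, written `T M L`. -/
abbrev OperatorSystem {F : Type u} [Field F] (ψ : AddChar F ℂ) (V : Symp.{u, v} F) :=
  ∀ M L : OrientedLagrangian V, modelSpace ψ L →ₗ[ℂ] modelSpace ψ M

/-- The one-dimensional Gauss sum `G₁ = ∑_z ψ(z²/2)`. -/
noncomputable def gaussSumOne {F : Type u} [Field F] [Fintype F] (ψ : AddChar F ℂ) : ℂ :=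
  ∑ z : F, ψ ((2 : F)⁻¹ * z ^ 2)

open Classical in
/-- The normalization constant `(G₁/q)ⁿ · σ((-1)^(n choose 2) ω_∧(o_L, o_M))`, where `σ` is the
quadratic character. -/
noncomputable def normConst {F : Type u} [Field F] [Fintype F] (ψ : AddChar F ℂ)
    {V : Symp.{u, v} F} (M L : OrientedLagrangian V) : ℂ :=
  (gaussSumOne ψ / (Fintype.card F : ℂ)) ^ V.halfDim *
    ((quadraticChar F ((-1) ^ (V.halfDim.choose 2) * omegaWedge L M L.o M.o) : ℤ) : ℂ)

/-- The canonical system of intertwining morphisms: intertwining, given by the explicit formula for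
pairs in general position, and multiplicative. -/
structure IsCanonicalSystem {F : Type u} [Field F] [Fintype F] (ψ : AddChar F ℂ)
    (V : Symp.{u, v} F) (T : OperatorSystem ψ V) : Prop where
  intertwining : ∀ M L h f, T M L (modelRep ψ L h f) = modelRep ψ M h (T M L f)
  restriction : ∀ M L : OrientedLagrangian V, L.L ⊓ M.L = ⊥ → ∀ (f : modelSpace ψ L) (h : Heis V),
    (T M L f).1 h = normConst ψ M L * ∑ᶠ m : M.L, f.1 (Heis.ofVec (m : V.carrier) * h)
  multiplicative : ∀ N M L, T N L = T N M ∘ₗ T M L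

/-- The canonical system `F_{M°,L°}`: the system singled out by `IsCanonicalSystem`. -/
noncomputable def canonicalSystem {F : Type u} [Field F] [Fintype F] (ψ : AddChar F ℂ)
    (V : Symp.{u, v} F) : OperatorSystem ψ V :=
  Classical.epsilon (IsCanonicalSystem ψ V)

/-- The total space `Γ(V)`, the direct sum of the `𝓗_{L°}` over the finite set of oriented
Lagrangians. -/
abbrev totalSpace {F : Type u} [Field F] (ψ : AddChar F ℂ) (V : Symp.{u, v} F) :=
  ∀ L : OrientedLagrangian V, modelSpace ψ L

/-- The canonical vector space `𝓗(V)`: families with `F_{M°,L°}(v_{L°}) = v_{M°}`. -/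
noncomputable def canonicalSpace {F : Type u} [Field F] [Fintype F] (ψ : AddChar F ℂ)
    (V : Symp.{u, v} F) : Submodule ℂ (totalSpace ψ V) where
  carrier := {v | ∀ M L, canonicalSystem ψ V M L (v L) = v M}
  zero_mem' := by simp
  add_mem' := by
    intro v w hv hw M L
    simp [hv M L, hw M L]
  smul_mem' := by
    intro c v hv M L
    simp [hv M L]

/-- The pullback `Γ(U) → Γ(V)` along a symplectic isomorphism `f : V → U`:
`(f^* v)_{L°}(h) = v_{f(L°)}(f(h))`. -/
noncomputable def pullback {F : Type u} [Field F] (ψ : AddChar F ℂ) {V U : Symp.{u, v} F} (f : V ⟶ U) :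
    totalSpace ψ U →ₗ[ℂ] totalSpace ψ V where
  toFun v := fun L => ⟨fun h => (v (L.map f)).1 (Heis.map f h),
    fun z h => by
      simpa only [map_mul, Heis.map_ofCenter] using (v (L.map f)).2.1 z (Heis.map f h),
    fun l hl h => by
      simpa only [map_mul, Heis.map_ofVec] using
        (v (L.map f)).2.2 (Symp.equiv f l) ⟨l, hl, rfl⟩ (Heis.map f h)⟩
  map_add' _ _ := rfl
  map_smul' _ _ := rfl

/-- `π` is the Heisenberg representation with central character `ψ` (irreducible, with the centre
acting through `ψ`), and the representation `ρ` of `Sp(V) = Aut V` on the same space is a Weil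
representation attached to it: `ρ(g) π(h) ρ(g)⁻¹ = π(g · h)`. -/
structure IsWeilRepresentation {F : Type u} [Field F] (ψ : AddChar F ℂ) (V : Symp.{u, v} F)
    {W : Type*} [AddCommGroup W] [Module ℂ W] (π : Representation ℂ (Heis V) W)
    (ρ : Representation ℂ (Aut V) W) : Prop where
  irreducible : π.IsIrreducible
  central : ∀ z w, π (Heis.ofCenter V z) w = ψ z • w
  compatible : ∀ g h w, ρ g (π h w) = π (Heis.map g.hom h) (ρ g w)

/-! An intertwiner between two models is determined by one scalar. The vector `modelDelta` generates
`𝓗_L` under the Heisenberg group and is invariant under `L`, and an `L`-invariant vector of `𝓗_M` is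
determined by its value at `1` (`modelSpace_eq_zero_of_invariant`). Every identity between
intertwiners is therefore checked by comparing two complex numbers (`intertwiner_ext`).

If `M` is transverse to `L` and `N`, projection along `M` is an isomorphism `β : L ≃ N`, and the
scalar of the composite of averagings `𝓗_L → 𝓗_M → 𝓗_N` is a product of normalization constants
times the Gauss sum of the symmetric form `ω(x, β y)` on `L`, whose kernel is `L ∩ N`. Another
choice `M'` replaces `β` by `β ∘ φ` with `φ` trivial on that kernel. Gauss sum and constants then
change by the same sign `σ(det φ)`, so the composite does not depend on `M`. For `L ∩ N = 0` it is
the averaging `𝓗_L → 𝓗_N` itself, and for `N = L` it is the identity; both follow from `G₁² = σ(-1)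
q`.

Since any three Lagrangians have a common transversal (`Symp.exists_lagrangian_disjoint`), these
composites form a multiplicative system, and any canonical system must be given by them. This yields
existence and uniqueness. Symplectic isomorphisms preserve the normalization constants, so pullback
commutes with averaging and hence with the whole system. Finally, evaluation at one `L°` identifies
`𝓗(V)` with `𝓗_{L°}`, which transfers finiteness and irreducibility. -/

/-- The quadratic character of a finite field with values in `ℂ`. -/
noncomputable def complexQuadraticChar (F : Type*) [Field F] [Fintype F] (a : F) : ℂ :=
  open Classical in ((quadraticChar F a : ℤ) : ℂ)

/-! ### The quadratic character and one-dimensional Gauss sums. -/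

section QuadraticChar

variable {F : Type*} [Field F] [Fintype F]

theorem complexQuadraticChar_mul (a b : F) :
    complexQuadraticChar F (a * b) = complexQuadraticChar F a * complexQuadraticChar F b := by
  rw [complexQuadraticChar, map_mul, Int.cast_mul]
  rfl

theorem complexQuadraticChar_one : complexQuadraticChar F 1 = 1 := by
  simp [complexQuadraticChar]

theorem complexQuadraticChar_mul_self {a : F} (ha : a ≠ 0) :
    complexQuadraticChar F a * complexQuadraticChar F a = 1 := by
  classical
  rw [complexQuadraticChar, ← Int.cast_mul, ← sq, ← Int.cast_one]
  congr 1
  convert quadraticChar_sq_one ha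

theorem complexQuadraticChar_prod {ι : Type*} [Fintype ι] (w : ι → F) :
    complexQuadraticChar F (∏ i, w i) = ∏ i, complexQuadraticChar F (w i) := by
  rw [complexQuadraticChar, map_prod, Int.cast_prod]
  rfl

theorem complexQuadraticChar_pow (a : F) (n : ℕ) :
    complexQuadraticChar F (a ^ n) = complexQuadraticChar F a ^ n := by
  rw [complexQuadraticChar, map_pow, Int.cast_pow]
  rfl

/-- The witness is the Gauss sum of the quadratic character: `y` has `1 + σ(y)` square roots, and
the contribution of the `1` vanishes because `ψ` is non-trivial. -/
theorem exists_gaussSum (hF : ringChar F ≠ 2) {ψ : AddChar F ℂ} (hψ : ψ ≠ 1) :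
    ∃ g : ℂ, g ^ 2 = complexQuadraticChar F (-1) * Fintype.card F ∧
      ∀ a : F, a ≠ 0 → ∑ x, ψ (a * x ^ 2) = complexQuadraticChar F a * g := by
  classical
  let χ : MulChar F ℂ := (quadraticChar F).ringHomComp (Int.castRingHom ℂ)
  have hχa : ∀ a, χ a = complexQuadraticChar F a := by
    intro a
    simp only [χ, MulChar.ringHomComp_apply, complexQuadraticChar, eq_intCast]
  have hχ : χ ≠ 1 :=
    (MulChar.ringHomComp_ne_one_iff (RingHom.injective_int (Int.castRingHom ℂ))).mpr
      (quadraticChar_ne_one hF)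
  have hq : χ.IsQuadratic := (quadraticChar_isQuadratic F).comp _
  refine ⟨gaussSum χ ψ, ?_, fun a ha => ?_⟩
  · rw [gaussSum_sq hχ hq (AddChar.IsPrimitive.of_ne_one hψ), hχa]
  · have h1 : ∑ x, ψ (a * x ^ 2) = ∑ y, (χ y + 1) * ψ (a * y) := by
      rw [← Finset.sum_fiberwise Finset.univ (fun x : F => x ^ 2)]
      refine Finset.sum_congr rfl fun y _ => ?_
      rw [Finset.sum_congr rfl (g := fun _ => ψ (a * y))
        (fun x hx => by rw [(Finset.mem_filter.mp hx).2]), Finset.sum_const, nsmul_eq_mul]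
      congr 1
      have := quadraticChar_card_sqrts hF y
      have h2 : (Finset.univ.filter fun x : F => x ^ 2 = y) = {x : F | x ^ 2 = y}.toFinset := by
        ext; simp
      rw [h2]
      have h3 := congrArg (fun n : ℤ => (n : ℂ)) this
      simpa [χ] using h3
    have h4 : ∑ y, ψ (a * y) = 0 := by
      have := AddChar.sum_eq_zero_of_ne_one (AddChar.IsPrimitive.of_ne_one hψ ha)
      simpa [AddChar.mulShift_apply] using this
    rw [h1]
    simp only [add_mul, one_mul, Finset.sum_add_distrib, h4, add_zero]
    have h5 := gaussSum_mulShift χ ψ (Units.mk0 a ha)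
    simp only [Units.val_mk0, hχa] at h5
    rw [← h5, ← mul_assoc, complexQuadraticChar_mul_self ha, one_mul]
    simp [gaussSum, AddChar.mulShift_apply]

theorem sum_addChar_half_mul_sq (hF : ringChar F ≠ 2) {ψ : AddChar F ℂ} (hψ : ψ ≠ 1) {a : F}
    (ha : a ≠ 0) :
    ∑ x, ψ ((2 : F)⁻¹ * (a * x ^ 2)) = complexQuadraticChar F a * gaussSumOne ψ := by
  obtain ⟨g, -, hg⟩ := exists_gaussSum hF hψ
  have h2 : (2 : F)⁻¹ ≠ 0 := inv_ne_zero (Ring.two_ne_zero hF)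
  rw [gaussSumOne, hg _ h2, ← mul_assoc, ← complexQuadraticChar_mul, mul_comm a,
    ← hg _ (mul_ne_zero h2 ha)]
  simp only [mul_assoc]

theorem gaussSumOne_sq (hF : ringChar F ≠ 2) {ψ : AddChar F ℂ} (hψ : ψ ≠ 1) :
    gaussSumOne ψ ^ 2 = complexQuadraticChar F (-1) * Fintype.card F := by
  obtain ⟨g, h, hg⟩ := exists_gaussSum hF hψ
  have h2 : (2 : F)⁻¹ ≠ 0 := inv_ne_zero (Ring.two_ne_zero hF)
  rw [gaussSumOne, hg _ h2, mul_pow, sq (complexQuadraticChar F _),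
    complexQuadraticChar_mul_self h2, one_mul, h]

end QuadraticChar

/-! ### Gauss sums of symmetric bilinear forms. -/

theorem addChar_sum {A M ι : Type*} [AddCommMonoid A] [CommMonoid M] (ψ : AddChar A M)
    (s : Finset ι) (f : ι → A) : ψ (∑ i ∈ s, f i) = ∏ i ∈ s, ψ (f i) := by
  classical
  induction s using Finset.induction_on with
  | empty => simp
  | insert i s hi ih => rw [Finset.sum_insert hi, Finset.prod_insert hi, ψ.map_add_eq_mul, ih]

/-- The Gauss sum `∑_w ψ(½ B(w, w))` of a bilinear form. -/
noncomputable def formGaussSum {F : Type*} [Field F] (ψ : AddChar F ℂ) {W : Type*}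
    [AddCommGroup W] [Module F W] (B : LinearMap.BilinForm F W) : ℂ :=
  ∑ᶠ w, ψ ((2 : F)⁻¹ * B w w)

section FormGaussSum

variable {F : Type*} [Field F] {W : Type*} [AddCommGroup W] [Module F W]

theorem restrict_nondegenerate_of_isCompl_ker {B : LinearMap.BilinForm F W} (hB : B.IsSymm)
    {C : Submodule F W} (hC : IsCompl (LinearMap.ker B) C) : (B.restrict C).Nondegenerate := by
  have hs : (B.restrict C).IsSymm := hB.restrict C
  have key : (B.restrict C).SeparatingLeft := by
    intro c hc
    have h : (c : W) ∈ LinearMap.ker B := by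
      rw [LinearMap.mem_ker]
      ext x
      obtain ⟨i, hi, c', hc', rfl⟩ := Submodule.mem_sup.mp (hC.sup_eq_top ▸ Submodule.mem_top :
        x ∈ LinearMap.ker B ⊔ C)
      have h1 : B c i = 0 := by rw [hB.eq, LinearMap.mem_ker.mp hi, LinearMap.zero_apply]
      rw [map_add, h1, zero_add]
      exact hc ⟨c', hc'⟩
    exact Subtype.ext (Submodule.disjoint_def.mp hC.disjoint _ h c.2)
  refine ⟨key, fun c hc => key c fun d => ?_⟩
  rw [hs.eq]
  exact hc d

variable [Fintype F]

theorem formGaussSum_of_isOrtho {ι : Type*} [Fintype ι] (ψ : AddChar F ℂ)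
    (B : LinearMap.BilinForm F W) (v : Module.Basis ι F W) (hv : B.IsOrthoᵢ v) :
    formGaussSum ψ B = ∏ i, ∑ x, ψ ((2 : F)⁻¹ * (B (v i) (v i) * x ^ 2)) := by
  classical
  rw [Finset.prod_univ_sum, Fintype.piFinset_univ, formGaussSum,
    ← finsum_comp_equiv v.equivFun.symm.toEquiv, finsum_eq_sum_of_fintype]
  refine Finset.sum_congr rfl fun x _ => ?_
  rw [← addChar_sum, ← Finset.mul_sum]
  congr 2
  simp only [LinearEquiv.coe_toEquiv, Module.Basis.equivFun_symm_apply, map_sum,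
    LinearMap.sum_apply, map_smul, LinearMap.smul_apply, smul_eq_mul]
  refine Finset.sum_congr rfl fun i _ => ?_
  rw [Finset.sum_eq_single i]
  · ring
  · intro j _ hj
    simp [show B (v j) (v i) = 0 from hv hj]
  · simp

variable [Module.Finite F W]

/-- An orthogonal basis splits the sum into one-dimensional Gauss sums. Passing to the given basis
changes the determinant by a non-zero square, which `σ` does not see. -/
theorem formGaussSum_of_nondegenerate (hF : ringChar F ≠ 2) {ψ : AddChar F ℂ} (hψ : ψ ≠ 1)
    {B : LinearMap.BilinForm F W} (hB : B.IsSymm) (hB' : B.Nondegenerate)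
    {ι : Type*} [Fintype ι] [DecidableEq ι] (b : Module.Basis ι F W) :
    formGaussSum ψ B =
      complexQuadraticChar F (LinearMap.BilinForm.toMatrix b B).det * gaussSumOne ψ ^ Fintype.card ι := by
  have : Invertible (2 : F) := invertibleOfNonzero (Ring.two_ne_zero hF)
  obtain ⟨v', hv'⟩ := LinearMap.BilinForm.exists_orthogonal_basis (LinearMap.BilinForm.isSymm_iff.mp hB)
  let e : Fin (Module.finrank F W) ≃ ι :=
    Fintype.equivOfCardEq (by rw [Fintype.card_fin, Module.finrank_eq_card_basis b])
  let v := v'.reindex e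
  have hv : B.IsOrthoᵢ v := fun i j hij => by
    simpa [v, Function.onFun] using hv' (e.symm.injective.ne hij)
  have hdiag : LinearMap.BilinForm.toMatrix v B = Matrix.diagonal fun i => B (v i) (v i) := by
    ext i j
    rw [LinearMap.BilinForm.toMatrix_apply, Matrix.diagonal_apply]
    split_ifs with h
    · rw [h]
    · exact hv h
  have hw : ∏ i, B (v i) (v i) ≠ 0 := by
    have := (LinearMap.BilinForm.nondegenerate_iff_det_ne_zero v).mp hB'
    rwa [hdiag, Matrix.det_diagonal] at this
  have hdet : (LinearMap.BilinForm.toMatrix b B).det =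
      (v.toMatrix b).det * (∏ i, B (v i) (v i)) * (v.toMatrix b).det := by
    rw [← LinearMap.BilinForm.toMatrix_mul_basis_toMatrix v b, hdiag, Matrix.det_mul, Matrix.det_mul,
      Matrix.det_transpose, Matrix.det_diagonal]
  have hP : (v.toMatrix b).det ≠ 0 := by
    have := (LinearMap.BilinForm.nondegenerate_iff_det_ne_zero b).mp hB'
    rw [hdet] at this
    exact right_ne_zero_of_mul this
  rw [formGaussSum_of_isOrtho ψ B v hv, hdet, complexQuadraticChar_mul, complexQuadraticChar_mul,
    mul_right_comm (complexQuadraticChar F _) (complexQuadraticChar F _),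
    complexQuadraticChar_mul_self hP, one_mul, complexQuadraticChar_prod,
    ← Finset.card_univ, ← Finset.prod_const, ← Finset.prod_mul_distrib]
  refine Finset.prod_congr rfl fun i _ => sum_addChar_half_mul_sq hF hψ ?_
  exact fun h => hw (Finset.prod_eq_zero (Finset.mem_univ i) h)

/-- The quadratic function is constant along the cosets of the radical. -/
theorem formGaussSum_eq_card_ker_mul (ψ : AddChar F ℂ) {B : LinearMap.BilinForm F W}
    (hB : B.IsSymm) {C : Submodule F W} (hC : IsCompl (LinearMap.ker B) C) :
    formGaussSum ψ B = Nat.card (LinearMap.ker B) * formGaussSum ψ (B.restrict C) := by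
  classical
  have : Finite W := Module.finite_of_finite F
  have := Fintype.ofFinite W
  rw [formGaussSum, ← finsum_comp_equiv (Submodule.prodEquivOfIsCompl _ _ hC).toEquiv,
    finsum_eq_sum_of_fintype, Fintype.sum_prod_type, formGaussSum, finsum_eq_sum_of_fintype,
    Nat.card_eq_fintype_card, ← nsmul_eq_mul, ← Finset.card_univ, ← Finset.sum_const]
  refine Finset.sum_congr rfl fun i _ => Finset.sum_congr rfl fun c _ => ?_
  have h1 : B i = 0 := i.2
  have h2 : B c i = 0 := by rw [hB.eq, h1, LinearMap.zero_apply]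
  simp [h1, h2]

/-- Twisting a symmetric bilinear form by an automorphism which is trivial on the kernel multiplies
its Gauss sum by the quadratic character of the determinant. -/
theorem formGaussSum_compRight (hF : ringChar F ≠ 2) {ψ : AddChar F ℂ} (hψ : ψ ≠ 1)
    {B B' : LinearMap.BilinForm F W} (hB : B.IsSymm) (hB' : B'.IsSymm) (φ : W ≃ₗ[F] W)
    (hφ : ∀ x y, B' x y = B x (φ y)) (hker : ∀ x ∈ LinearMap.ker B, φ x = x) :
    formGaussSum ψ B' = complexQuadraticChar F (LinearMap.det φ.toLinearMap) *
      formGaussSum ψ B := by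
  classical
  obtain ⟨C, hC⟩ := Submodule.exists_isCompl (LinearMap.ker B)
  have hK : LinearMap.ker B' = LinearMap.ker B := by
    ext x
    rw [LinearMap.mem_ker, LinearMap.mem_ker]
    constructor
    · intro h
      ext y
      rw [← φ.apply_symm_apply y, ← hφ, h]
      rfl
    · intro h
      ext y
      rw [hφ, h]
      rfl
  have hC' : IsCompl (LinearMap.ker B') C := hK ▸ hC
  let e := Submodule.quotientEquivOfIsCompl _ _ hC
  have hle : LinearMap.ker B ≤ (LinearMap.ker B).comap φ.toLinearMap := fun x hx => by
    rw [Submodule.mem_comap, LinearEquiv.coe_coe, hker x hx]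
    exact hx
  -- `φ` need not preserve `C`; the map it induces on the quotient by the kernel is carried over to
  -- `C` as `D`. As `φ` is the identity on the kernel, `det D = det φ`.
  let Q := (LinearMap.ker B).mapQ (LinearMap.ker B) φ.toLinearMap hle
  let D : C →ₗ[F] C := e.toLinearMap ∘ₗ Q ∘ₗ e.symm.toLinearMap
  have hres : φ.toLinearMap.restrict hle = LinearMap.id := by
    ext x
    exact hker x x.2
  have hdet : LinearMap.det φ.toLinearMap = LinearMap.det D := by
    rw [LinearMap.det_eq_det_mul_det (LinearMap.ker B) φ.toLinearMap hle, hres, LinearMap.det_id,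
      one_mul, LinearMap.det_conj]
  have hD : ∀ c : C, φ c - (D c : W) ∈ LinearMap.ker B := by
    intro c
    rw [← Submodule.Quotient.mk_eq_zero, Submodule.Quotient.mk_sub, sub_eq_zero]
    have h1 : (Submodule.Quotient.mk (D c : W) : W ⧸ LinearMap.ker B) = Q (e.symm c) :=
      Submodule.mk_quotientEquivOfIsCompl_apply hC _
    rw [h1]
    rfl
  -- `φ c` and `D c` differ by an element of the kernel of `B`, invisible to `B`.
  have hres' : B'.restrict C = (B.restrict C).compRight D := by
    ext x y
    have h1 : B x (φ y - (D y : W)) = 0 := by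
      rw [hB.eq, LinearMap.mem_ker.mp (hD y), LinearMap.zero_apply]
    rw [map_sub, sub_eq_zero] at h1
    exact (hφ x y).trans h1
  let b := Module.finBasis F C
  rw [formGaussSum_eq_card_ker_mul ψ hB hC, formGaussSum_eq_card_ker_mul ψ hB' hC', hK,
    formGaussSum_of_nondegenerate hF hψ (hB.restrict C)
      (restrict_nondegenerate_of_isCompl_ker hB hC) b,
    formGaussSum_of_nondegenerate hF hψ (hB'.restrict C)
      (restrict_nondegenerate_of_isCompl_ker hB' hC') b, hres',
    LinearMap.BilinForm.toMatrix_compRight, Matrix.det_mul, LinearMap.det_toMatrix, hdet,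
    complexQuadraticChar_mul]
  ring

end FormGaussSum

/-! ### Common Lagrangian complements. -/

theorem Submodule.exists_notMem_three {F V : Type*} [Field F] [AddCommGroup V] [Module F V]
    (h2 : (2 : F) ≠ 0) {A B C : Submodule F V} (hA : A ≠ ⊤) (hB : B ≠ ⊤) (hC : C ≠ ⊤) :
    ∃ v, v ∉ A ∧ v ∉ B ∧ v ∉ C := by
  have pair : ∀ A B : Submodule F V, A ≠ ⊤ → B ≠ ⊤ → ∃ v, v ∉ A ∧ v ∉ B := by
    intro A B hA hB
    obtain ⟨a, ha⟩ := SetLike.exists_not_mem_of_ne_top A hA rfl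
    obtain ⟨b, hb⟩ := SetLike.exists_not_mem_of_ne_top B hB rfl
    by_cases h1 : a ∈ B
    · by_cases h2 : b ∈ A
      · refine ⟨a + b, fun h => ha ?_, fun h => hb ?_⟩
        · simpa using A.sub_mem h h2
        · simpa using B.sub_mem h h1
      · exact ⟨b, h2, hb⟩
    · exact ⟨a, ha, h1⟩
  obtain ⟨v, hvA, hvB⟩ := pair A B hA hB
  by_cases hvC : v ∈ C
  swap
  · exact ⟨v, hvA, hvB, hvC⟩
  obtain ⟨w, hw⟩ := SetLike.exists_not_mem_of_ne_top C hC rfl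
  -- The line `w + t v` misses `C` and meets each of `A` and `B` at most once, while `0`, `1`, `-1`
  -- are three distinct parameters because `2 ≠ 0`.
  have shift : ∀ t : F, w + t • v ∉ C := fun t h => hw <| by
    simpa using C.sub_mem h (C.smul_mem t hvC)
  have atMost : ∀ (D : Submodule F V), v ∉ D → ∀ s t : F, s ≠ t → w + s • v ∈ D →
      w + t • v ∉ D := by
    intro D hD s t hst h1 h3
    have h4 : (s - t) • v ∈ D := by
      have := D.sub_mem h1 h3
      rwa [add_sub_add_left_eq_sub, ← sub_smul] at this
    exact hD ((D.smul_mem_iff (sub_ne_zero.mpr hst)).mp h4)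
  have h01 : (0 : F) ≠ 1 := zero_ne_one
  have h0m : (0 : F) ≠ -1 := by simp
  have h1m : (1 : F) ≠ -1 := fun h => h2 (by linear_combination h)
  by_contra! hcover
  have cover : ∀ t : F, w + t • v ∈ A ∨ w + t • v ∈ B := fun t => by
    by_contra! h
    exact shift t (hcover _ h.1 h.2)
  rcases cover 0 with a0 | b0
  · have b1 := (cover 1).resolve_left (atMost A hvA _ _ h01 a0)
    exact (cover (-1)).elim (atMost A hvA _ _ h0m a0) (atMost B hvB _ _ h1m b1)
  · have a1 := (cover 1).resolve_right (atMost B hvB _ _ h01 b0)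
    exact (cover (-1)).elim (atMost A hvA _ _ h1m a1) (atMost B hvB _ _ h0m b0)

namespace Symp

variable {F : Type u} [Field F] (V : Symp.{u, v} F)

theorem form_neg (x y : V.carrier) : -V.form x y = V.form y x :=
  LinearMap.IsAlt.neg V.isAlt x y

/-- Three isotropic subspaces of a symplectic space have a common Lagrangian complement. -/
theorem exists_lagrangian_disjoint (h2 : (2 : F) ≠ 0) {A B C : Submodule F V.carrier}
    (hA : ∀ x ∈ A, ∀ y ∈ A, V.form x y = 0) (hB : ∀ x ∈ B, ∀ y ∈ B, V.form x y = 0)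
    (hC : ∀ x ∈ C, ∀ y ∈ C, V.form x y = 0) :
    ∃ Z : Submodule F V.carrier, V.form.orthogonal Z = Z ∧ Z ⊓ A = ⊥ ∧ Z ⊓ B = ⊥ ∧
      Z ⊓ C = ⊥ := by
  have hrefl : V.form.IsRefl := V.isAlt.isRefl
  let S : Set (Submodule F V.carrier) :=
    {Z | Z ≤ V.form.orthogonal Z ∧ Z ⊓ A = ⊥ ∧ Z ⊓ B = ⊥ ∧ Z ⊓ C = ⊥}
  -- A maximal isotropic subspace among those meeting `A`, `B`, `C` trivially; it is Lagrangian, for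
  -- otherwise it could be enlarged.
  obtain ⟨Z, hZS, hmax⟩ : ∃ Z ∈ S, ∀ Y ∈ S, ¬ Z < Y :=
    WellFounded.has_min (wellFounded_gt (α := Submodule F V.carrier)) S ⟨⊥, by simp [S]⟩
  obtain ⟨hZ, hZA, hZB, hZC⟩ := hZS
  refine ⟨Z, ?_, hZA, hZB, hZC⟩
  by_contra hne
  set O := V.form.orthogonal Z with hO
  have memO : ∀ {x}, x ∈ O ↔ ∀ z ∈ Z, V.form z x = 0 := by
    intro x
    rw [hO, LinearMap.BilinForm.mem_orthogonal_iff]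
  -- If `Z + (D ∩ Z^⊥)` filled `Z^⊥`, then `Z^⊥` would be isotropic, hence contained in `Z^⊥⊥ = Z`.
  -- A vector of `Z^⊥` outside all three such subspaces can be added to `Z`.
  have proper : ∀ D : Submodule F V.carrier, (∀ x ∈ D, ∀ y ∈ D, V.form x y = 0) →
      (Z ⊔ D ⊓ O).comap O.subtype ≠ ⊤ := by
    intro D hD htop
    rw [Submodule.comap_subtype_eq_top] at htop
    refine hne (le_antisymm ?_ hZ)
    have : O ≤ V.form.orthogonal O := by
      intro x hx
      rw [LinearMap.BilinForm.mem_orthogonal_iff]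
      intro y hy
      obtain ⟨z, hz, d, hd, rfl⟩ := Submodule.mem_sup.mp (htop hx)
      obtain ⟨z', hz', d', hd', rfl⟩ := Submodule.mem_sup.mp (htop hy)
      have e1 : V.form z' z = 0 := memO.mp (hZ hz) z' hz'
      have e2 : V.form z' d = 0 := memO.mp hd.2 z' hz'
      have e3 : V.form d' z = 0 := by
        rw [← V.form_neg, memO.mp hd'.2 z hz, neg_zero]
      have e4 : V.form d' d = 0 := hD _ hd'.1 _ hd.1
      simp [e1, e2, e3, e4]
    rwa [hO, LinearMap.BilinForm.orthogonal_orthogonal V.nondegenerate hrefl] at this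
  obtain ⟨⟨v, hvO⟩, hvA, hvB, hvC⟩ :=
    Submodule.exists_notMem_three h2 (proper A hA) (proper B hB) (proper C hC)
  simp only [Submodule.mem_comap, Submodule.subtype_apply] at hvA hvB hvC
  have hvZ : v ∉ Z := fun h => hvA (Submodule.mem_sup_left h)
  have inter : ∀ D : Submodule F V.carrier, Z ⊓ D = ⊥ → v ∉ Z ⊔ D ⊓ O →
      (Z ⊔ F ∙ v) ⊓ D = ⊥ := by
    intro D hD hv
    rw [eq_bot_iff]
    rintro x ⟨hx, hxD⟩
    obtain ⟨z, hz, y, hy, rfl⟩ := Submodule.mem_sup.mp hx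
    obtain ⟨t, rfl⟩ := Submodule.mem_span_singleton.mp hy
    by_cases ht : t = 0
    · subst ht
      rw [← hD]
      exact ⟨by simpa using hz, hxD⟩
    · refine absurd ?_ hv
      have hxO : z + t • v ∈ O := O.add_mem (hZ hz) (O.smul_mem t hvO)
      have : t • v ∈ Z ⊔ D ⊓ O := by
        have h3 := (Z ⊔ D ⊓ O).sub_mem (Submodule.mem_sup_right ⟨hxD, hxO⟩)
          (Submodule.mem_sup_left hz)
        simpa using h3
      exact ((Z ⊔ D ⊓ O).smul_mem_iff ht).mp this
  refine hmax (Z ⊔ F ∙ v) ⟨?_, inter A hZA hvA, inter B hZB hvB, inter C hZC hvC⟩ ?_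
  · intro x hx
    rw [LinearMap.BilinForm.mem_orthogonal_iff]
    intro y hy
    obtain ⟨z, hz, a, ha, rfl⟩ := Submodule.mem_sup.mp hx
    obtain ⟨t, rfl⟩ := Submodule.mem_span_singleton.mp ha
    obtain ⟨z', hz', a', ha', rfl⟩ := Submodule.mem_sup.mp hy
    obtain ⟨t', rfl⟩ := Submodule.mem_span_singleton.mp ha'
    have e1 : V.form z' z = 0 := memO.mp (hZ hz) z' hz'
    have e2 : V.form z' v = 0 := memO.mp hvO z' hz'
    have e3 : V.form v z = 0 := by
      rw [← V.form_neg, memO.mp hvO z hz, neg_zero]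
    have e4 : V.form v v = 0 := V.isAlt v
    simp [e1, e2, e3, e4]
  · refine lt_of_le_of_ne le_sup_left fun h => hvZ ?_
    rw [h]
    exact Submodule.mem_sup_right (Submodule.mem_span_singleton_self v)

theorem finrank_eq_halfDim {Z : Submodule F V.carrier} (hZ : V.form.orthogonal Z = Z) :
    Module.finrank F Z = V.halfDim := by
  have h := LinearMap.BilinForm.finrank_add_finrank_orthogonal' (B := V.form) Z
  rw [hZ, V.nondegenerate.ker_eq_bot, inf_bot_eq, finrank_bot, add_zero] at h
  rw [halfDim]
  omega

end Symp

/-! ### Orientations in bases and the normalization constant. -/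

theorem exteriorPower.ιMulti_basis_ne_zero {F W : Type*} [Field F] [AddCommGroup W] [Module F W]
    {n : ℕ} (b : Module.Basis (Fin n) F W) : exteriorPower.ιMulti F n b ≠ 0 := by
  intro h
  have h1 := exteriorPower.alternatingMapLinearEquiv_apply_ιMulti b.det b
  rw [h, map_zero, b.det_self] at h1
  exact zero_ne_one h1

theorem exteriorPower.exists_smul_ιMulti_basis {F W : Type*} [Field F] [AddCommGroup W]
    [Module F W] {n : ℕ} (b : Module.Basis (Fin n) F W) (x : ⋀[F]^n W) :
    ∃ c : F, x = c • exteriorPower.ιMulti F n b := by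
  have : Module.Finite F W := Module.Finite.of_basis b
  have h1 : Module.finrank F (⋀[F]^n W) = 1 := by
    rw [exteriorPower.finrank_eq, Module.finrank_eq_card_basis b, Fintype.card_fin, Nat.choose_self]
  obtain ⟨c, hc⟩ := (finrank_eq_one_iff_of_nonzero' _
    (exteriorPower.ιMulti_basis_ne_zero b)).mp h1 x
  exact ⟨c, hc.symm⟩

namespace OrientedLagrangian

variable {F : Type u} [Field F] {V U : Symp.{u, v} F}

theorem exists_of_orthogonal_eq {Z : Submodule F V.carrier} (hZ : V.form.orthogonal Z = Z) :
    ∃ A : OrientedLagrangian V, A.L = Z := by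
  let b := Module.finBasisOfFinrankEq F Z (V.finrank_eq_halfDim hZ)
  refine ⟨⟨Z, hZ, exteriorPower.ιMulti F _ b, (exteriorPower.ιMulti F _ b).2, fun h => ?_⟩, rfl⟩
  exact exteriorPower.ιMulti_basis_ne_zero b (Subtype.ext h)

theorem form_eq_zero (A : OrientedLagrangian V) {x y : V.carrier} (hx : x ∈ A.L) (hy : y ∈ A.L) :
    V.form x y = 0 := by
  rw [← A.orthogonal_eq] at hy
  exact hy x hx

theorem mem_of_forall_form_eq_zero (A : OrientedLagrangian V) {y : V.carrier}
    (h : ∀ x ∈ A.L, V.form x y = 0) : y ∈ A.L := by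
  rw [← A.orthogonal_eq]
  exact h

theorem exists_disjoint (h2 : (2 : F) ≠ 0) (A B C : OrientedLagrangian V) :
    ∃ Z : OrientedLagrangian V, Z.L ⊓ A.L = ⊥ ∧ Z.L ⊓ B.L = ⊥ ∧ Z.L ⊓ C.L = ⊥ := by
  obtain ⟨Z, hZ, h⟩ := V.exists_lagrangian_disjoint h2 (fun _ hx _ => A.form_eq_zero hx)
    (fun _ hx _ => B.form_eq_zero hx) (fun _ hx _ => C.form_eq_zero hx)
  obtain ⟨Y, rfl⟩ := exists_of_orthogonal_eq hZ
  exact ⟨Y, h⟩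

theorem nonempty (h2 : (2 : F) ≠ 0) (V : Symp.{u, v} F) : Nonempty (OrientedLagrangian V) := by
  have h : ∀ x ∈ (⊥ : Submodule F V.carrier), ∀ y ∈ (⊥ : Submodule F V.carrier),
      V.form x y = 0 := by
    intro x hx
    simp [(Submodule.mem_bot F).mp hx]
  obtain ⟨Z, hZ, -⟩ := V.exists_lagrangian_disjoint h2 h h h
  exact ⟨(exists_of_orthogonal_eq hZ).choose⟩

theorem finrank_eq (A : OrientedLagrangian V) : Module.finrank F A.L = V.halfDim :=
  V.finrank_eq_halfDim A.orthogonal_eq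

theorem isCompl {A B : OrientedLagrangian V} (h : A.L ⊓ B.L = ⊥) : IsCompl A.L B.L := by
  refine ⟨disjoint_iff.mpr h, codisjoint_iff.mpr ?_⟩
  apply Submodule.eq_top_of_finrank_eq
  have h1 := Submodule.finrank_sup_add_finrank_inf_eq A.L B.L
  rw [h, finrank_bot, add_zero, A.finrank_eq] at h1
  rw [h1]
  have h3 := LinearMap.BilinForm.finrank_add_finrank_orthogonal' (B := V.form) A.L
  rw [A.orthogonal_eq, V.nondegenerate.ker_eq_bot, inf_bot_eq, finrank_bot, add_zero,
    A.finrank_eq] at h3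
  rw [B.finrank_eq, h3]

theorem exists_orientation_eq (A : OrientedLagrangian V) {n : ℕ} (hn : V.halfDim = n)
    (b : Module.Basis (Fin n) F A.L) :
    ∃ c : F, c ≠ 0 ∧ A.orientation = c • ExteriorAlgebra.ιMulti F n b := by
  subst hn
  obtain ⟨c, hc⟩ := exteriorPower.exists_smul_ιMulti_basis b A.o
  have hc' : A.orientation = c • ExteriorAlgebra.ιMulti F _ b := congrArg Subtype.val hc
  refine ⟨c, ?_, hc'⟩
  rintro rfl
  exact A.orientation_ne (by rw [hc', zero_smul])

end OrientedLagrangian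

section NormConst

variable {F : Type u} [Field F] [Fintype F] (ψ : AddChar F ℂ) {V U : Symp.{u, v} F}

/-- The sign in `normConst` cancels the one in `omegaWedge`. The free index `n` allows bases of
Lagrangians of `U` to be indexed by the half-dimension of an isomorphic `V`. -/
theorem normConst_eq (M L : OrientedLagrangian V) {n : ℕ} (hn : V.halfDim = n)
    {l : Fin n → L.L} {m : Fin n → M.L} {c d : F}
    (hL : L.orientation = c • ExteriorAlgebra.ιMulti F n l)
    (hM : M.orientation = d • ExteriorAlgebra.ιMulti F n m) :
    normConst ψ M L = (gaussSumOne ψ / (Fintype.card F : ℂ)) ^ n *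
      complexQuadraticChar F
        (c * d * (Matrix.of fun i j => V.form (l i : V.carrier) (m j)).det) := by
  subst hn
  have hL' : L.o = c • exteriorPower.ιMulti F _ l := Subtype.ext hL
  have hM' : M.o = d • exteriorPower.ιMulti F _ m := Subtype.ext hM
  have h1 : ((-1 : F) ^ V.halfDim.choose 2) * (-1 : F) ^ V.halfDim.choose 2 = 1 := by
    rw [← mul_pow]
    simp
  rw [normConst, hL', hM', map_smul, map_smul, LinearMap.smul_apply, omegaWedge_ιMulti]
  rw [show (-1 : F) ^ V.halfDim.choose 2 * d • c • ((-1 : F) ^ V.halfDim.choose 2 *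
    (Matrix.of fun i j => V.form (l i : V.carrier) (m j)).det) =
    c * d * (Matrix.of fun i j => V.form (l i : V.carrier) (m j)).det by
      simp only [smul_eq_mul]
      linear_combination (c * d * (Matrix.of fun i j => V.form (l i : V.carrier) (m j)).det) * h1]
  rfl

theorem normConst_map (f : V ⟶ U) (M L : OrientedLagrangian V) :
    normConst ψ (M.map f) (L.map f) = normConst ψ M L := by
  let l := Module.finBasisOfFinrankEq F L.L L.finrank_eq
  let m := Module.finBasisOfFinrankEq F M.L M.finrank_eq
  obtain ⟨c, -, hc⟩ := L.exists_orientation_eq rfl l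
  obtain ⟨d, -, hd⟩ := M.exists_orientation_eq rfl m
  have hmap : ∀ (A : OrientedLagrangian V) (c : F) (b : Fin V.halfDim → A.L),
      A.orientation = c • ExteriorAlgebra.ιMulti F _ b →
      (A.map f).orientation = c • ExteriorAlgebra.ιMulti F _
        (fun i => (Symp.equiv f).submoduleMap A.L (b i)) := by
    intro A c b h
    change ExteriorAlgebra.map _ A.orientation = _
    rw [h, map_smul, ExteriorAlgebra.map_apply_ιMulti]
    rfl
  rw [normConst_eq ψ M L rfl hc hd,
    normConst_eq ψ (M.map f) (L.map f) (Symp.halfDim_eq f).symm (hmap L c l hc) (hmap M d m hd)]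
  simp [Symp.form_equiv]

end NormConst

/-! ### The models: generation, rigidity of intertwiners, irreducibility. -/

section ModelSpace

variable {F : Type u} [Field F] {V : Symp.{u, v} F} {ψ : AddChar F ℂ}

theorem Heis.ofVec_mul_ofVec (x y : V.carrier) :
    (Heis.ofVec x * Heis.ofVec y : Heis V) =
      Heis.ofCenter V ((2 : F)⁻¹ * V.form x y) * Heis.ofVec (x + y) := by
  ext <;> simp [Heis.ofVec, Heis.ofCenter]

theorem Heis.eq_ofCenter_mul_ofVec (h : Heis V) :
    h = Heis.ofCenter V h.cen * Heis.ofVec h.vec := by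
  ext <;> simp [Heis.ofVec, Heis.ofCenter]

theorem Heis.ofVec_zero : (Heis.ofVec 0 : Heis V) = 1 := rfl

@[simp]
theorem modelRep_apply (A : OrientedLagrangian V) (h : Heis V) (f : modelSpace ψ A) (k : Heis V) :
    (modelRep ψ A h f).1 k = f.1 (k * h) := rfl

theorem modelSpace_apply {A : OrientedLagrangian V} (f : modelSpace ψ A) (h : Heis V) :
    f.1 h = ψ h.cen * f.1 (Heis.ofVec h.vec) := by
  conv_lhs => rw [Heis.eq_ofCenter_mul_ofVec h]
  exact f.2.1 _ _

theorem modelSpace_apply_ofVec_mul {A : OrientedLagrangian V} (f : modelSpace ψ A)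
    (x y : V.carrier) :
    f.1 (Heis.ofVec x * Heis.ofVec y) = ψ ((2 : F)⁻¹ * V.form x y) * f.1 (Heis.ofVec (x + y)) := by
  rw [Heis.ofVec_mul_ofVec]
  exact f.2.1 _ _

theorem modelSpace_ext {A : OrientedLagrangian V} {f g : modelSpace ψ A}
    (h : ∀ x, f.1 (Heis.ofVec x) = g.1 (Heis.ofVec x)) : f = g := by
  ext k
  rw [modelSpace_apply f, modelSpace_apply g, h]

theorem modelSpace_apply_add {A : OrientedLagrangian V} (f : modelSpace ψ A)
    {l : V.carrier} (hl : l ∈ A.L) (x : V.carrier) :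
    f.1 (Heis.ofVec (l + x)) = ψ (-((2 : F)⁻¹ * V.form l x)) * f.1 (Heis.ofVec x) := by
  rw [← f.2.2 l hl (Heis.ofVec x), modelSpace_apply_ofVec_mul, ← mul_assoc, ← ψ.map_add_eq_mul,
    neg_add_cancel, ψ.map_zero_eq_one, one_mul]

open Classical in
/-- The function of `𝓗_L` supported on the product of `L` and the centre, with value `1` at `1`. -/
noncomputable def modelDelta (ψ : AddChar F ℂ) (A : OrientedLagrangian V) : modelSpace ψ A :=
  ⟨fun h => if h.vec ∈ A.L then ψ h.cen else 0, fun z h => by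
    simp [Heis.ofCenter, ψ.map_add_eq_mul], fun l hl h => by
    by_cases hh : h.vec ∈ A.L
    · simp [Heis.ofVec, hh, A.L.add_mem hl hh, A.form_eq_zero hl hh]
    · have : l + h.vec ∉ A.L := fun h' => hh (by simpa using A.L.sub_mem h' hl)
      simp [Heis.ofVec, hh, this]⟩

theorem modelDelta_apply_of_mem {A : OrientedLagrangian V} {h : Heis V} (hh : h.vec ∈ A.L) :
    (modelDelta ψ A).1 h = ψ h.cen := by
  classical
  exact if_pos hh

theorem modelDelta_apply_of_notMem {A : OrientedLagrangian V} {h : Heis V} (hh : h.vec ∉ A.L) :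
    (modelDelta ψ A).1 h = 0 := by
  classical
  exact if_neg hh

theorem modelDelta_apply_one (A : OrientedLagrangian V) : (modelDelta ψ A).1 1 = 1 := by
  rw [modelDelta_apply_of_mem (by simp)]
  simp

theorem modelRep_ofVec_modelDelta {A : OrientedLagrangian V} {l : V.carrier} (hl : l ∈ A.L) :
    modelRep ψ A (Heis.ofVec l) (modelDelta ψ A) = modelDelta ψ A := by
  refine modelSpace_ext fun x => ?_
  rw [modelRep_apply]
  by_cases hx : x ∈ A.L
  · rw [modelDelta_apply_of_mem (A.L.add_mem hx hl), modelDelta_apply_of_mem hx]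
    simp [Heis.ofVec, A.form_eq_zero hx hl]
  · rw [modelDelta_apply_of_notMem (h := Heis.ofVec x) hx, modelDelta_apply_of_notMem]
    intro h
    exact hx (by simpa [Heis.ofVec] using A.L.sub_mem h hl)

theorem OrientedLagrangian.orthogonal_inf (A B : OrientedLagrangian V) :
    V.form.orthogonal (A.L ⊓ B.L) = A.L ⊔ B.L := by
  have h : V.form.orthogonal (A.L ⊔ B.L) = A.L ⊓ B.L := by
    conv_rhs => rw [← A.orthogonal_eq, ← B.orthogonal_eq]
    ext x
    simp only [Submodule.mem_inf, LinearMap.BilinForm.mem_orthogonal_iff]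
    constructor
    · exact fun h => ⟨fun y hy => h y (Submodule.mem_sup_left hy),
        fun y hy => h y (Submodule.mem_sup_right hy)⟩
    · rintro ⟨h1, h2⟩ y hy
      obtain ⟨a, ha, b, hb, rfl⟩ := Submodule.mem_sup.mp hy
      have e1 : V.form a x = 0 := h1 a ha
      have e2 : V.form b x = 0 := h2 b hb
      change V.form (a + b) x = 0
      rw [map_add, LinearMap.add_apply, e1, e2, add_zero]
  rw [← h]
  exact LinearMap.BilinForm.orthogonal_orthogonal V.nondegenerate V.isAlt.isRefl _

/-- A function of `𝓗_B` which is right invariant under `A` is determined by its value at `1`. -/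
theorem modelSpace_eq_zero_of_invariant (hψ : ψ ≠ 1) (h2 : (2 : F) ≠ 0)
    {A B : OrientedLagrangian V} {g : modelSpace ψ B}
    (hg : ∀ l ∈ A.L, modelRep ψ B (Heis.ofVec l) g = g) (h1 : g.1 1 = 0) : g = 0 := by
  have hinv : ∀ l ∈ A.L, ∀ h, g.1 (h * Heis.ofVec l) = g.1 h := fun l hl h =>
    congrArg (fun f : modelSpace ψ B => f.1 h) (hg l hl)
  refine modelSpace_ext fun x => ?_
  change g.1 (Heis.ofVec x) = 0
  by_contra hx
  -- For `u ∈ A ∩ B`, moving `t u` from the right to the left of `x` gives `g(x) = ψ(t ω(x, u))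
  -- g(x)` for all `t`. So `g(x) ≠ 0` forces `ω(x, u) = 0`, and the support lies in `(A ∩ B)^⊥ = A +
  -- B`, where `g(1)` determines `g`.
  have horth : x ∈ V.form.orthogonal (A.L ⊓ B.L) := by
    rw [LinearMap.BilinForm.mem_orthogonal_iff]
    intro u hu
    change V.form u x = 0
    rw [← V.form_neg, neg_eq_zero]
    by_contra hne
    refine AddChar.IsPrimitive.of_ne_one hψ hne ?_
    ext t
    rw [AddChar.mulShift_apply, AddChar.one_apply]
    have htA := A.L.smul_mem t hu.1
    have htB := B.L.smul_mem t hu.2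
    have e1 := hinv _ htA (Heis.ofVec x)
    rw [modelSpace_apply_ofVec_mul, add_comm x, modelSpace_apply_add g htB, ← mul_assoc,
      ← ψ.map_add_eq_mul, mul_left_eq_self₀, or_iff_left hx] at e1
    rw [← e1]
    congr 1
    rw [← V.form_neg x (t • u), map_smul, smul_eq_mul]
    field_simp
    ring
  rw [A.orthogonal_inf] at horth
  obtain ⟨l, hl, n, hn, rfl⟩ := Submodule.mem_sup.mp horth
  have e2 := hinv l hl (Heis.ofVec n)
  rw [modelSpace_apply_ofVec_mul, add_comm n l] at e2
  have e3 : g.1 (Heis.ofVec n) = 0 := by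
    have := modelSpace_apply_add g hn 0
    rwa [add_zero, Heis.ofVec_zero, h1, mul_zero] at this
  rw [e3] at e2
  exact hx ((mul_eq_zero.mp e2).resolve_left (ψ.val_isUnit _).ne_zero)

end ModelSpace

section Fintype

variable {F : Type u} [Field F] [Fintype F] {V : Symp.{u, v} F} {ψ : AddChar F ℂ}

instance Symp.instFiniteCarrier : Finite V.carrier := Module.finite_of_finite F

instance Heis.instFinite : Finite (Heis V) :=
  Finite.of_injective (fun h => (h.vec, h.cen)) fun a b h => by
    ext
    · exact congrArg Prod.fst h
    · exact congrArg Prod.snd h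

/-- Every `f` is a combination of translates of `modelDelta`: the translate by `-y` lives on the
coset of `y` modulo `L`, and weighting it by `f(y)` reproduces `f` there. Each coset is counted
`|L|` times. -/
theorem modelSpace_eq_top (A : OrientedLagrangian V) (p : Submodule ℂ (modelSpace ψ A))
    (hp : ∀ h, modelRep ψ A h (modelDelta ψ A) ∈ p) : p = ⊤ := by
  classical
  have := Fintype.ofFinite V.carrier
  rw [eq_top_iff]
  intro f _
  have key : (Nat.card A.L : ℂ) • f =
      ∑ y : V.carrier, f.1 (Heis.ofVec y) • modelRep ψ A (Heis.ofVec (-y)) (modelDelta ψ A) := by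
    refine modelSpace_ext fun x => ?_
    have e : ∀ y : V.carrier, f.1 (Heis.ofVec y) *
        (modelDelta ψ A).1 (Heis.ofVec x * Heis.ofVec (-y)) =
        if x - y ∈ A.L then f.1 (Heis.ofVec x) else 0 := by
      intro y
      rw [modelSpace_apply_ofVec_mul, ← sub_eq_add_neg]
      split_ifs with h
      · rw [modelDelta_apply_of_mem h]
        have := modelSpace_apply_add f h y
        rw [sub_add_cancel] at this
        rw [this]
        have h3 : V.form (x - y) y = V.form x y := by simp [V.isAlt y]
        simp only [h3, map_neg, mul_neg]
        simp [Heis.ofVec, mul_comm]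
      · rw [modelDelta_apply_of_notMem h]
        simp
    have e2 : (∑ y : V.carrier, f.1 (Heis.ofVec y) •
        modelRep ψ A (Heis.ofVec (-y)) (modelDelta ψ A)).1 (Heis.ofVec x) =
        ∑ y : V.carrier, f.1 (Heis.ofVec y) *
          (modelDelta ψ A).1 (Heis.ofVec x * Heis.ofVec (-y)) := by
      rw [Submodule.coe_sum, Finset.sum_apply]
      rfl
    rw [e2, Finset.sum_congr rfl fun y _ => e y, ← Finset.sum_filter, Finset.sum_const,
      nsmul_eq_mul]
    change (Nat.card A.L : ℂ) * _ = _
    congr 2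
    rw [← Fintype.card_subtype, ← Nat.card_eq_fintype_card]
    exact Nat.card_congr
      { toFun := fun l => ⟨x - l, by simp⟩
        invFun := fun y => ⟨x - y, y.2⟩
        left_inv := fun l => by simp
        right_inv := fun y => by simp }
  have hc : (Nat.card A.L : ℂ) ≠ 0 := Nat.cast_ne_zero.mpr Nat.card_pos.ne'
  rw [← p.smul_mem_iff hc, key]
  exact p.sum_mem fun y _ => p.smul_mem _ (hp _)

/-- An intertwiner between two models is determined by the value at `1` of the image of
`modelDelta`. -/
theorem intertwiner_ext (hψ : ψ ≠ 1) (h2 : (2 : F) ≠ 0) {A B : OrientedLagrangian V}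
    {S T : modelSpace ψ A →ₗ[ℂ] modelSpace ψ B}
    (hS : ∀ h f, S (modelRep ψ A h f) = modelRep ψ B h (S f))
    (hT : ∀ h f, T (modelRep ψ A h f) = modelRep ψ B h (T f))
    (h1 : (S (modelDelta ψ A)).1 1 = (T (modelDelta ψ A)).1 1) : S = T := by
  have h0 : S (modelDelta ψ A) - T (modelDelta ψ A) = 0 := by
    refine modelSpace_eq_zero_of_invariant hψ h2 (A := A) (fun l hl => ?_) ?_
    · rw [map_sub, ← hS, ← hT, modelRep_ofVec_modelDelta hl]
    · exact sub_eq_zero.mpr h1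
  rw [← LinearMap.eqLocus_eq_top]
  refine modelSpace_eq_top A _ fun h => ?_
  rw [LinearMap.mem_eqLocus, hS, hT, sub_eq_zero.mp h0]

/-- The models of the Heisenberg representation are irreducible. -/
theorem modelSpace_irreducible (hψ : ψ ≠ 1) (h2 : (2 : F) ≠ 0) {A : OrientedLagrangian V}
    (p : Submodule ℂ (modelSpace ψ A)) (hp : ∀ h, ∀ f ∈ p, modelRep ψ A h f ∈ p) (hne : p ≠ ⊥) :
    p = ⊤ := by
  classical
  obtain ⟨f, hf, hf0⟩ := p.exists_mem_ne_zero_of_ne_bot hne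
  obtain ⟨k, hk⟩ : ∃ k, f.1 k ≠ 0 := by
    by_contra! h
    exact hf0 (Subtype.ext (funext h))
  have := Fintype.ofFinite A.L
  let f' := modelRep ψ A k f
  -- Averaging over `L` a translate of `f` that is non-zero at `1` gives an `L`-invariant vector
  -- with `g(1) ≠ 0`, hence a non-zero multiple of `modelDelta`.
  let g : modelSpace ψ A := ∑ l : A.L, modelRep ψ A (Heis.ofVec (l : V.carrier)) f'
  have hg : g ∈ p := p.sum_mem fun l _ => hp _ _ (hp _ _ hf)
  have hg1 : g.1 1 = Fintype.card A.L * f.1 k := by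
    have : g.1 1 = ∑ l : A.L, f.1 (1 * Heis.ofVec (l : V.carrier) * k) := by
      simp only [g]
      rw [Submodule.coe_sum, Finset.sum_apply]
      rfl
    rw [this, Finset.sum_congr rfl (g := fun _ => f.1 k), Finset.sum_const, Finset.card_univ,
      nsmul_eq_mul]
    intro l _
    rw [one_mul, f.2.2 _ l.2]
  have hinv : ∀ l ∈ A.L, modelRep ψ A (Heis.ofVec l) g = g := by
    intro l hl
    simp only [g, map_sum]
    refine Fintype.sum_equiv (Equiv.addLeft ⟨l, hl⟩) _ _ fun l' => ?_
    rw [← Module.End.mul_apply, ← map_mul, Heis.ofVec_mul_ofVec, A.form_eq_zero hl l'.2, mul_zero]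
    exact congrArg (fun h => modelRep ψ A h f') (one_mul _)
  have hc : (Fintype.card A.L : ℂ) * f.1 k ≠ 0 :=
    mul_ne_zero (Nat.cast_ne_zero.mpr Fintype.card_ne_zero) hk
  have h0 : g - g.1 1 • modelDelta ψ A = 0 := by
    refine modelSpace_eq_zero_of_invariant hψ h2 (A := A) (fun l hl => ?_) ?_
    · rw [map_sub, map_smul, hinv l hl, modelRep_ofVec_modelDelta hl]
    · change g.1 1 - g.1 1 * (modelDelta ψ A).1 1 = 0
      rw [modelDelta_apply_one, mul_one, sub_self]
  have hδ : modelDelta ψ A ∈ p := by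
    rw [← p.smul_mem_iff (hg1 ▸ hc), ← sub_eq_zero.mp h0]
    exact hg
  exact modelSpace_eq_top A p fun h => hp h _ hδ

end Fintype

/-! ### Averaging operators. -/

section Averaging

variable {F : Type u} [Field F] {V : Symp.{u, v} F} {ψ : AddChar F ℂ}

theorem Heis.ofVec_mul_ofCenter_mul (x : V.carrier) (z : F) (h : Heis V) :
    Heis.ofVec x * (Heis.ofCenter V z * h) = Heis.ofCenter V z * (Heis.ofVec x * h) := by
  ext
  · simp [Heis.ofVec, Heis.ofCenter]
  · simp only [Heis.ofVec, Heis.ofCenter, Heis.cen_mul, Heis.vec_mul, map_zero,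
      LinearMap.zero_apply, zero_add]
    ring
variable [Fintype F]

/-- The normalized averaging operator `𝓗_L → 𝓗_M`,
`f ↦ (h ↦ normConst · ∑_{m ∈ M} f(m · h))`. -/
noncomputable def averaging (ψ : AddChar F ℂ) (M L : OrientedLagrangian V) :
    modelSpace ψ L →ₗ[ℂ] modelSpace ψ M where
  toFun f := ⟨fun h => normConst ψ M L * ∑ᶠ m : M.L, f.1 (Heis.ofVec (m : V.carrier) * h),
    fun z h => by
      simp only [Heis.ofVec_mul_ofCenter_mul, f.2.1]
      rw [← mul_finsum, mul_left_comm],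
    fun l hl h => by
      refine congrArg (normConst ψ M L * ·) ?_
      rw [← finsum_comp_equiv (Equiv.addRight (⟨l, hl⟩ : M.L))
        (f := fun m : M.L => f.1 (Heis.ofVec (m : V.carrier) * h))]
      refine finsum_congr fun m => ?_
      rw [← mul_assoc, Heis.ofVec_mul_ofVec, M.form_eq_zero m.2 hl, mul_zero]
      exact congrArg (fun k => f.1 (k * h)) (one_mul _)⟩
  map_add' f g := by
    ext h
    change normConst ψ M L * ∑ᶠ m : M.L, (f.1 _ + g.1 _) = normConst ψ M L * _ +
      normConst ψ M L * _
    rw [finsum_add_distrib (Set.toFinite _) (Set.toFinite _), mul_add]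
  map_smul' c f := by
    ext h
    change normConst ψ M L * ∑ᶠ m : M.L, (c * f.1 _) = c * (normConst ψ M L * _)
    rw [← mul_finsum, mul_left_comm]

theorem averaging_apply (M L : OrientedLagrangian V) (f : modelSpace ψ L) (h : Heis V) :
    (averaging ψ M L f).1 h =
      normConst ψ M L * ∑ᶠ m : M.L, f.1 (Heis.ofVec (m : V.carrier) * h) := rfl

theorem averaging_intertwining (M L : OrientedLagrangian V) (h : Heis V) (f : modelSpace ψ L) :
    averaging ψ M L (modelRep ψ L h f) = modelRep ψ M h (averaging ψ M L f) := by
  ext k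
  simp only [averaging_apply, modelRep_apply, mul_assoc]

theorem averaging_modelDelta_apply_one {M L : OrientedLagrangian V} (h : L.L ⊓ M.L = ⊥) :
    (averaging ψ M L (modelDelta ψ L)).1 1 = normConst ψ M L := by
  rw [averaging_apply, finsum_eq_single _ (0 : M.L), mul_one]
  · change _ * (modelDelta ψ L).1 1 = _
    rw [modelDelta_apply_one, mul_one]
  · intro m hm
    refine modelDelta_apply_of_notMem fun hmem => hm ?_
    have : (m : V.carrier) ∈ L.L ⊓ M.L := ⟨by simpa [Heis.ofVec] using hmem, m.2⟩
    rw [h] at this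
    exact Subtype.ext this

end Averaging

/-! ### The symmetric form attached to two Lagrangians and a common complement. -/

namespace OrientedLagrangian

variable {F : Type u} [Field F] {V : Symp.{u, v} F}

/-- The identification of two complements of `M` by projection along `M`. -/
theorem exists_equiv_sub_mem {M L N : OrientedLagrangian V} (hL : M.L ⊓ L.L = ⊥)
    (hN : M.L ⊓ N.L = ⊥) :
    ∃ β : L.L ≃ₗ[F] N.L, ∀ l, (β l : V.carrier) - l ∈ M.L := by
  refine ⟨(Submodule.quotientEquivOfIsCompl _ _ (isCompl hL)).symm ≪≫ₗ
    Submodule.quotientEquivOfIsCompl _ _ (isCompl hN), fun l => ?_⟩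
  rw [← Submodule.Quotient.mk_eq_zero, Submodule.Quotient.mk_sub, sub_eq_zero]
  exact Submodule.mk_quotientEquivOfIsCompl_apply (isCompl hN) _

variable {M L N : OrientedLagrangian V}

/-- The form `(x, y) ↦ ω(x, β y)` on `L`, whose discriminant governs the composition of averaging
operators. -/
def relForm (L N : OrientedLagrangian V) (β : L.L ≃ₗ[F] N.L) : LinearMap.BilinForm F L.L :=
  V.form.compl₁₂ L.L.subtype (N.L.subtype ∘ₗ β.toLinearMap)

theorem relForm_apply (β : L.L ≃ₗ[F] N.L) (x y : L.L) :
    relForm L N β x y = V.form x (β y) := rfl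

theorem form_left_eq (β : L.L ≃ₗ[F] N.L) (hβ : ∀ l, (β l : V.carrier) - l ∈ M.L)
    {m : V.carrier} (hm : m ∈ M.L) (l : L.L) : V.form m (β l) = V.form m l := by
  rw [← sub_eq_zero, ← map_sub]
  exact M.form_eq_zero hm (hβ l)

/-- Expand `ω(β x - x, β y - y) = 0`, which holds in the isotropic `M`, and use that `L` and `N` are
isotropic. -/
theorem relForm_isSymm (β : L.L ≃ₗ[F] N.L) (hβ : ∀ l, (β l : V.carrier) - l ∈ M.L) :
    (relForm L N β).IsSymm := by
  refine ⟨fun x y => ?_⟩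
  have h1 := M.form_eq_zero (hβ x) (hβ y)
  have h2 := N.form_eq_zero (β x).2 (β y).2
  have h3 := L.form_eq_zero x.2 y.2
  have h4 := V.form_neg (y : V.carrier) (β x)
  simp only [map_sub, LinearMap.sub_apply] at h1
  rw [relForm_apply, relForm_apply]
  linear_combination h2 + h3 - h1 + h4

/-- As `β` is onto `N`, the kernel is `L ∩ N^⊥ = L ∩ N`. It does not depend on `M`. -/
theorem mem_ker_relForm (β : L.L ≃ₗ[F] N.L) {x : L.L} :
    x ∈ LinearMap.ker (relForm L N β) ↔ (x : V.carrier) ∈ N.L := by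
  constructor
  · intro h
    refine N.mem_of_forall_form_eq_zero fun n hn => ?_
    have h1 := LinearMap.congr_fun (LinearMap.mem_ker.mp h) (β.symm ⟨n, hn⟩)
    rw [relForm_apply, LinearEquiv.apply_symm_apply] at h1
    rw [← V.form_neg, neg_eq_zero]
    exact h1
  · intro h
    rw [LinearMap.mem_ker]
    ext y
    exact N.form_eq_zero h (β y).2

theorem equiv_apply_of_mem (β : L.L ≃ₗ[F] N.L) (hβ : ∀ l, (β l : V.carrier) - l ∈ M.L)
    (hN : M.L ⊓ N.L = ⊥) {x : L.L} (hx : (x : V.carrier) ∈ N.L) : (β x : V.carrier) = x := by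
  have h : (β x : V.carrier) - x ∈ M.L ⊓ N.L := ⟨hβ x, N.L.sub_mem (β x).2 hx⟩
  rw [hN] at h
  exact sub_eq_zero.mp h

theorem relForm_nondegenerate (β : L.L ≃ₗ[F] N.L) (hβ : ∀ l, (β l : V.carrier) - l ∈ M.L)
    (h : L.L ⊓ N.L = ⊥) : (relForm L N β).Nondegenerate := by
  have key : (relForm L N β).SeparatingLeft := by
    intro x hx
    have h1 : x ∈ LinearMap.ker (relForm L N β) := LinearMap.mem_ker.mpr (LinearMap.ext hx)
    have h2 : (x : V.carrier) ∈ L.L ⊓ N.L := ⟨x.2, (mem_ker_relForm β).mp h1⟩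
    rw [h] at h2
    exact Subtype.ext h2
  refine ⟨key, fun x hx => key x fun y => ?_⟩
  rw [(relForm_isSymm β hβ).eq]
  exact hx y

/-- A linear relation among the columns gives a vector of `M` orthogonal to `L`, hence in `L ∩ M =
0`. -/
theorem det_form_ne_zero {n : ℕ} (h : M.L ⊓ L.L = ⊥) (l : Module.Basis (Fin n) F L.L)
    (m : Module.Basis (Fin n) F M.L) :
    (Matrix.of fun i j => V.form (l i : V.carrier) (m j)).det ≠ 0 := by
  intro h0
  obtain ⟨c, hc, hc0⟩ := Matrix.exists_mulVec_eq_zero_iff.mpr h0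
  refine hc ?_
  let y : M.L := ∑ j, c j • m j
  have hy : ∀ i, V.form (l i : V.carrier) y = 0 := by
    intro i
    have := congrFun hc0 i
    simpa [y, Matrix.mulVec, dotProduct, mul_comm] using this
  have hyL : (y : V.carrier) ∈ L.L := by
    refine L.mem_of_forall_form_eq_zero fun x hx => ?_
    have h1 : (V.form.flip y) ∘ₗ L.L.subtype = 0 := l.ext fun i => hy i
    exact LinearMap.congr_fun h1 ⟨x, hx⟩
  have hy0 : y = 0 := by
    have h2 : (y : V.carrier) ∈ M.L ⊓ L.L := ⟨y.2, hyL⟩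
    rw [h] at h2
    exact Subtype.ext h2
  funext i
  exact Fintype.linearIndependent_iff.mp m.linearIndependent c hy0 i

/-- Replacing the family `β ∘ l` by another family `b` in `N` multiplies the determinant of the
pairing matrix by the determinant of the transition matrix. -/
theorem det_form_eq_mul_det {n : ℕ} (x : Fin n → V.carrier) (β : L.L ≃ₗ[F] N.L)
    (l : Module.Basis (Fin n) F L.L) (b : Fin n → N.L) :
    (Matrix.of fun i j => V.form (x i) (b j)).det =
      (Matrix.of fun i j => V.form (x i) (β (l j))).det * (l.toMatrix (β.symm ∘ b)).det := by
  rw [← Matrix.det_mul]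
  congr 1
  ext i j
  rw [Matrix.mul_apply, Matrix.of_apply]
  have h1 : (b j : V.carrier) =
      ∑ k, l.toMatrix (β.symm ∘ b) k j • (β (l k) : V.carrier) := by
    have h2 := l.sum_toMatrix_smul_self (β.symm ∘ b) j
    have h3 := congrArg (fun y => (β y : V.carrier)) h2
    simp only [map_sum, map_smul, Function.comp_apply, LinearEquiv.apply_symm_apply] at h3
    rw [← h3]
    simp
  conv_lhs => rw [h1]
  simp [mul_comm]

end OrientedLagrangian

/-! ### Composition of averaging operators. -/

section Composition

open OrientedLagrangian

variable {F : Type u} [Field F] [Fintype F] {V : Symp.{u, v} F} {ψ : AddChar F ℂ}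
  {M L N : OrientedLagrangian V}

/-- Write the outer variable as `β l`. In the inner sum over `M` only `m = l - β l` brings `m + β l`
into `L`, and it contributes `ψ(½ ω(l, β l))`. -/
theorem averaging_averaging_modelDelta (hL : M.L ⊓ L.L = ⊥)
    (β : L.L ≃ₗ[F] N.L) (hβ : ∀ l, (β l : V.carrier) - l ∈ M.L) :
    (averaging ψ N M (averaging ψ M L (modelDelta ψ L))).1 1 =
      normConst ψ N M * normConst ψ M L * formGaussSum ψ (relForm L N β) := by
  rw [averaging_apply, mul_assoc]
  congr 1
  rw [formGaussSum, mul_finsum, ← finsum_comp_equiv β.toEquiv]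
  refine finsum_congr fun l => ?_
  rw [averaging_apply, mul_one]
  congr 1
  have hm : (l : V.carrier) - β l ∈ M.L := by
    rw [← neg_sub]
    exact M.L.neg_mem (hβ l)
  rw [finsum_eq_single _ (⟨(l : V.carrier) - β l, hm⟩ : M.L)]
  · rw [modelDelta_apply_of_mem (by simp [Heis.ofVec])]
    simp [Heis.ofVec, relForm_apply, V.isAlt (β l : V.carrier)]
  · intro m hne
    refine modelDelta_apply_of_notMem fun hmem => hne ?_
    have h1 : (m : V.carrier) + β l ∈ L.L := hmem
    have h2 : (m : V.carrier) - (l - β l) ∈ M.L ⊓ L.L := by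
      refine ⟨M.L.sub_mem m.2 hm, ?_⟩
      have := L.L.sub_mem h1 l.2
      rwa [SetLike.mem_coe, sub_sub_eq_add_sub]
    rw [hL] at h2
    exact Subtype.ext (sub_eq_zero.mp h2)

/-- The basis and orientation of `M` enter both factors, so they contribute squares and drop out.
Only the determinant of `β⁻¹ b` in the basis `l` remembers `M`. -/
theorem normConst_mul_normConst (hL : M.L ⊓ L.L = ⊥) (β : L.L ≃ₗ[F] N.L)
    (hβ : ∀ l, (β l : V.carrier) - l ∈ M.L) {n : ℕ} (hn : V.halfDim = n)
    (l : Module.Basis (Fin n) F L.L) (b : Module.Basis (Fin n) F N.L) {c d : F}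
    (hc : L.orientation = c • ExteriorAlgebra.ιMulti F n l)
    (hd : N.orientation = d • ExteriorAlgebra.ιMulti F n b) :
    normConst ψ N M * normConst ψ M L =
      ((gaussSumOne ψ / (Fintype.card F : ℂ)) ^ n) ^ 2 * complexQuadraticChar F (-1) ^ n *
        complexQuadraticChar F (c * d) *
        complexQuadraticChar F (l.toMatrix (β.symm ∘ b)).det := by
  let m := Module.finBasisOfFinrankEq F M.L (M.finrank_eq.trans hn)
  obtain ⟨e, he0, he⟩ := M.exists_orientation_eq hn m
  rw [normConst_eq ψ N M hn he hd, normConst_eq ψ M L hn hc he,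
    det_form_eq_mul_det _ β l b]
  set X := (Matrix.of fun i j => V.form (l i : V.carrier) (m j)) with hX
  have hX0 : X.det ≠ 0 := det_form_ne_zero hL l m
  -- `β l - l` lies in the isotropic `M`, so pairing with `M` does not distinguish `β l` from `l`.
  have h1 : (Matrix.of fun i j => V.form (m i : V.carrier) (β (l j))) = -X.transpose := by
    ext i j
    rw [Matrix.of_apply, form_left_eq β hβ (m i).2, Matrix.neg_apply, Matrix.transpose_apply, hX,
      Matrix.of_apply, V.form_neg]
  rw [h1, Matrix.det_neg, Matrix.det_transpose, Fintype.card_fin]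
  simp only [complexQuadraticChar_mul, complexQuadraticChar_pow]
  linear_combination ((gaussSumOne ψ / (Fintype.card F : ℂ)) ^ n) ^ 2 *
    complexQuadraticChar F (-1) ^ n * complexQuadraticChar F c * complexQuadraticChar F d *
    complexQuadraticChar F (l.toMatrix (β.symm ∘ b)).det *
    (complexQuadraticChar F e * complexQuadraticChar F e * complexQuadraticChar_mul_self hX0 +
      complexQuadraticChar_mul_self he0)

/-- The composite of two averaging operators through a common complement `M` of `L` and `N` does
not depend on `M`. -/
theorem averaging_comp_averaging_eq (hF : ringChar F ≠ 2) (hψ : ψ ≠ 1)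
    {M' : OrientedLagrangian V} (hL : M.L ⊓ L.L = ⊥) (hN : M.L ⊓ N.L = ⊥)
    (hL' : M'.L ⊓ L.L = ⊥) (hN' : M'.L ⊓ N.L = ⊥) :
    averaging ψ N M ∘ₗ averaging ψ M L = averaging ψ N M' ∘ₗ averaging ψ M' L := by
  refine intertwiner_ext hψ (Ring.two_ne_zero hF)
    (fun h f => by simp [averaging_intertwining]) (fun h f => by simp [averaging_intertwining]) ?_
  obtain ⟨β, hβ⟩ := exists_equiv_sub_mem hL hN
  obtain ⟨β', hβ'⟩ := exists_equiv_sub_mem hL' hN'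
  let l := Module.finBasisOfFinrankEq F L.L L.finrank_eq
  let b := Module.finBasisOfFinrankEq F N.L N.finrank_eq
  obtain ⟨c, hc0, hc⟩ := L.exists_orientation_eq rfl l
  obtain ⟨d, hd0, hd⟩ := N.exists_orientation_eq rfl b
  rw [LinearMap.comp_apply, LinearMap.comp_apply, averaging_averaging_modelDelta hL β hβ,
    averaging_averaging_modelDelta hL' β' hβ', normConst_mul_normConst hL β hβ rfl l b hc hd,
    normConst_mul_normConst hL' β' hβ' rfl l b hc hd]
  -- `φ = β⁻¹ ∘ β'` compares the two projections. It fixes `L ∩ N`, where both are the identity, so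
  -- `formGaussSum_compRight` applies; the resulting sign is cancelled through `hdet`.
  let φ : L.L ≃ₗ[F] L.L := β' ≪≫ₗ β.symm
  have hφ : ∀ x y, relForm L N β' x y = relForm L N β x (φ y) := fun x y => by
    simp [relForm_apply, φ]
  have hker : ∀ x ∈ LinearMap.ker (relForm L N β), φ x = x := by
    intro x hx
    have hxN := (mem_ker_relForm β).mp hx
    change β.symm (β' x) = x
    rw [LinearEquiv.symm_apply_eq]
    exact Subtype.ext ((equiv_apply_of_mem β' hβ' hN' hxN).trans
      (equiv_apply_of_mem β hβ hN hxN).symm)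
  rw [formGaussSum_compRight hF hψ (relForm_isSymm β hβ) (relForm_isSymm β' hβ') φ hφ hker]
  have hdet : (l.toMatrix (β.symm ∘ b)).det =
      LinearMap.det φ.toLinearMap * (l.toMatrix (β'.symm ∘ b)).det := by
    have h1 := linearMap_toMatrix_mul_basis_toMatrix (b.map β'.symm) l l φ.toLinearMap
    have h2 : ⇑(b.map β'.symm) = β'.symm ∘ b := rfl
    rw [← LinearMap.det_toMatrix l, ← Matrix.det_mul, ← h2, h1]
    congr 1
    ext i j
    simp [LinearMap.toMatrix_apply, Module.Basis.toMatrix_apply, φ]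
  rw [hdet, complexQuadraticChar_mul (LinearMap.det _)]
  ring

/-- Transversality of `L` and `N` makes the form non-degenerate, with Gauss sum `σ(det) G₁ⁿ`. The
factor `(G₁/q)ⁿ` in the normalization is what makes `G₁² = σ(-1) q` absorb this sum. -/
theorem averaging_comp_averaging_of_disjoint (hF : ringChar F ≠ 2) (hψ : ψ ≠ 1)
    (hL : M.L ⊓ L.L = ⊥) (hN : M.L ⊓ N.L = ⊥) (hLN : L.L ⊓ N.L = ⊥) :
    averaging ψ N M ∘ₗ averaging ψ M L = averaging ψ N L := by
  refine intertwiner_ext hψ (Ring.two_ne_zero hF)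
    (fun h f => by simp [averaging_intertwining]) (fun h f => averaging_intertwining _ _ _ _) ?_
  obtain ⟨β, hβ⟩ := exists_equiv_sub_mem hL hN
  let l := Module.finBasisOfFinrankEq F L.L L.finrank_eq
  let b := Module.finBasisOfFinrankEq F N.L N.finrank_eq
  obtain ⟨c, hc0, hc⟩ := L.exists_orientation_eq rfl l
  obtain ⟨d, hd0, hd⟩ := N.exists_orientation_eq rfl b
  rw [LinearMap.comp_apply, averaging_averaging_modelDelta hL β hβ,
    normConst_mul_normConst hL β hβ rfl l b hc hd, averaging_modelDelta_apply_one hLN,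
    normConst_eq ψ N L rfl hc hd, det_form_eq_mul_det _ β l b,
    formGaussSum_of_nondegenerate hF hψ (relForm_isSymm β hβ) (relForm_nondegenerate β hβ hLN) l]
  have hmat : LinearMap.BilinForm.toMatrix l (relForm L N β) =
      Matrix.of fun i j => V.form (l i : V.carrier) (β (l j)) := by
    ext i j
    rw [LinearMap.BilinForm.toMatrix_apply]
    rfl
  have hq : (Fintype.card F : ℂ) ≠ 0 := Nat.cast_ne_zero.mpr Fintype.card_ne_zero
  have hs : complexQuadraticChar F (-1) * complexQuadraticChar F (-1) = 1 :=
    complexQuadraticChar_mul_self (by simp)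
  have hG : (gaussSumOne ψ / (Fintype.card F : ℂ)) * complexQuadraticChar F (-1) *
      gaussSumOne ψ = 1 := by
    have := gaussSumOne_sq hF hψ
    field_simp
    linear_combination complexQuadraticChar F (-1) * this + (Fintype.card F : ℂ) * hs
  have hGn := congrArg (· ^ V.halfDim) hG
  simp only [mul_pow, one_pow] at hGn
  rw [hmat, Fintype.card_fin]
  simp only [complexQuadraticChar_mul]
  linear_combination (gaussSumOne ψ / (Fintype.card F : ℂ)) ^ V.halfDim *
    complexQuadraticChar F c * complexQuadraticChar F d *
    complexQuadraticChar F (l.toMatrix (β.symm ∘ b)).det *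
    complexQuadraticChar F (Matrix.of fun i j => V.form (l i : V.carrier) (β (l j))).det * hGn

/-- Here `β` is the identity and the form vanishes, so the Gauss sum is `|L| = qⁿ`. -/
theorem averaging_comp_averaging_self (hF : ringChar F ≠ 2) (hψ : ψ ≠ 1)
    (hL : M.L ⊓ L.L = ⊥) : averaging ψ L M ∘ₗ averaging ψ M L = LinearMap.id := by
  refine intertwiner_ext hψ (Ring.two_ne_zero hF)
    (fun h f => by simp [averaging_intertwining]) (fun h f => rfl) ?_
  let l := Module.finBasisOfFinrankEq F L.L L.finrank_eq
  obtain ⟨c, hc0, hc⟩ := L.exists_orientation_eq rfl l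
  have hβ : ∀ x : L.L, (LinearEquiv.refl F L.L x : V.carrier) - x ∈ M.L := by simp
  rw [LinearMap.comp_apply, averaging_averaging_modelDelta hL _ hβ,
    normConst_mul_normConst hL _ hβ rfl l l hc hc, LinearMap.id_apply, modelDelta_apply_one]
  have h1 : l.toMatrix ((LinearEquiv.refl F L.L).symm ∘ l) = 1 := l.toMatrix_self
  have h2 : formGaussSum ψ (relForm L L (LinearEquiv.refl F L.L)) =
      (Fintype.card F : ℂ) ^ V.halfDim := by
    have : Fintype L.L := Fintype.ofFinite _
    have e : ∀ w : L.L, ψ ((2 : F)⁻¹ * relForm L L (LinearEquiv.refl F L.L) w w) = 1 := by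
      intro w
      rw [relForm_apply, LinearEquiv.refl_apply, V.isAlt, mul_zero, ψ.map_zero_eq_one]
    rw [formGaussSum, finsum_congr e, finsum_eq_sum_of_fintype, Finset.sum_const, Finset.card_univ,
      nsmul_eq_mul, mul_one, Module.card_eq_pow_finrank (K := F), L.finrank_eq, Nat.cast_pow]
  have hq : (Fintype.card F : ℂ) ≠ 0 := Nat.cast_ne_zero.mpr Fintype.card_ne_zero
  have hs : complexQuadraticChar F (-1) * complexQuadraticChar F (-1) = 1 :=
    complexQuadraticChar_mul_self (by simp)
  have hG : (gaussSumOne ψ / (Fintype.card F : ℂ)) ^ 2 * complexQuadraticChar F (-1) *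
      Fintype.card F = 1 := by
    have := gaussSumOne_sq hF hψ
    field_simp
    linear_combination complexQuadraticChar F (-1) * this + (Fintype.card F : ℂ) * hs
  rw [h1, h2, Matrix.det_one, complexQuadraticChar_one, complexQuadraticChar_mul,
    complexQuadraticChar_mul_self hc0, ← pow_mul, mul_comm V.halfDim, pow_mul, mul_one, mul_one,
    ← mul_pow, ← mul_pow, hG, one_pow]

end Composition

/-! ### Existence and uniqueness of the canonical system; evaluation at a Lagrangian. -/

section CanonicalSystem

open OrientedLagrangian

variable {F : Type u} [Field F] [Fintype F] {V U : Symp.{u, v} F} {ψ : AddChar F ℂ}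

theorem IsCanonicalSystem.eq_averaging {T : OperatorSystem ψ V} (hT : IsCanonicalSystem ψ V T)
    {M L : OrientedLagrangian V} (h : L.L ⊓ M.L = ⊥) : T M L = averaging ψ M L := by
  ext f k
  exact hT.restriction M L h f k

theorem IsCanonicalSystem.eq_averaging_comp {T : OperatorSystem ψ V}
    (hT : IsCanonicalSystem ψ V T) {M L N : OrientedLagrangian V} (hL : M.L ⊓ L.L = ⊥)
    (hN : M.L ⊓ N.L = ⊥) : T N L = averaging ψ N M ∘ₗ averaging ψ M L := by
  rw [hT.multiplicative N M L, hT.eq_averaging hN, hT.eq_averaging (inf_comm M.L L.L ▸ hL)]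

theorem exists_isCanonicalSystem (hF : ringChar F ≠ 2) (hψ : ψ ≠ 1) (V : Symp.{u, v} F) :
    ∃ T : OperatorSystem ψ V, IsCanonicalSystem ψ V T := by
  have h2 : (2 : F) ≠ 0 := Ring.two_ne_zero hF
  choose Z hZ using fun N L : OrientedLagrangian V => exists_disjoint h2 L N N
  let T : OperatorSystem ψ V := fun N L => averaging ψ N (Z N L) ∘ₗ averaging ψ (Z N L) L
  have hT : ∀ {N M L : OrientedLagrangian V}, M.L ⊓ L.L = ⊥ → M.L ⊓ N.L = ⊥ →
      T N L = averaging ψ N M ∘ₗ averaging ψ M L := fun {N M L} hL hN =>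
    averaging_comp_averaging_eq hF hψ (hZ N L).1 (hZ N L).2.1 hL hN
  refine ⟨T, ⟨fun M L h f => by simp [T, averaging_intertwining], fun M L h f k => ?_,
    fun N M L => ?_⟩⟩
  · obtain ⟨Y, hL, hM, -⟩ := exists_disjoint h2 L M M
    rw [hT hL hM, averaging_comp_averaging_of_disjoint hF hψ hL hM h, averaging_apply]
  -- Routing all three operators through one `Y` leaves the round trip `𝓗_Y → 𝓗_M → 𝓗_Y` in the
  -- middle, which is the identity.
  · obtain ⟨Y, hL, hM, hN⟩ := exists_disjoint h2 L M N
    rw [hT hL hN, hT hL hM, hT hM hN, LinearMap.comp_assoc,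
      ← LinearMap.comp_assoc (averaging ψ Y L),
      averaging_comp_averaging_self hF hψ (inf_comm Y.L M.L ▸ hM), LinearMap.id_comp]

theorem existsUnique_isCanonicalSystem (hF : ringChar F ≠ 2) (hψ : ψ ≠ 1) (V : Symp.{u, v} F) :
    ∃! T : OperatorSystem ψ V, IsCanonicalSystem ψ V T := by
  obtain ⟨T, hT⟩ := exists_isCanonicalSystem hF hψ V
  refine ⟨T, hT, fun T' hT' => ?_⟩
  funext N L
  obtain ⟨Y, hL, hN, -⟩ := exists_disjoint (Ring.two_ne_zero hF) L N N
  rw [hT.eq_averaging_comp hL hN, hT'.eq_averaging_comp hL hN]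

theorem isCanonicalSystem_canonicalSystem (hF : ringChar F ≠ 2) (hψ : ψ ≠ 1)
    (V : Symp.{u, v} F) : IsCanonicalSystem ψ V (canonicalSystem ψ V) :=
  Classical.epsilon_spec (exists_isCanonicalSystem hF hψ V)

theorem IsCanonicalSystem.self_eq_id {T : OperatorSystem ψ V} (hT : IsCanonicalSystem ψ V T)
    (hF : ringChar F ≠ 2) (hψ : ψ ≠ 1) (L : OrientedLagrangian V) : T L L = LinearMap.id := by
  obtain ⟨Y, hL, -⟩ := exists_disjoint (Ring.two_ne_zero hF) L L L
  rw [hT.eq_averaging_comp hL hL, averaging_comp_averaging_self hF hψ hL]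

/-- Evaluation at an oriented Lagrangian identifies the canonical space with the model. -/
noncomputable def canonicalSpaceEquiv (hF : ringChar F ≠ 2) (hψ : ψ ≠ 1)
    (L : OrientedLagrangian V) : canonicalSpace ψ V ≃ₗ[ℂ] modelSpace ψ L where
  toFun w := w.1 L
  map_add' _ _ := rfl
  map_smul' _ _ := rfl
  invFun f := ⟨fun M => canonicalSystem ψ V M L f, fun N M =>
    (LinearMap.congr_fun
      ((isCanonicalSystem_canonicalSystem hF hψ V).multiplicative N M L) f).symm⟩
  left_inv w := Subtype.ext (funext fun M => w.2 M L)
  right_inv f := by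
    change canonicalSystem ψ V L L f = f
    rw [(isCanonicalSystem_canonicalSystem hF hψ V).self_eq_id hF hψ, LinearMap.id_apply]

theorem canonicalSpace_finite (hF : ringChar F ≠ 2) (hψ : ψ ≠ 1) (V : Symp.{u, v} F) :
    Module.Finite ℂ (canonicalSpace ψ V) := by
  obtain ⟨L⟩ := OrientedLagrangian.nonempty (Ring.two_ne_zero hF) V
  exact Module.Finite.equiv (canonicalSpaceEquiv hF hψ L).symm

end CanonicalSystem

/-! ### Functoriality of pullback. -/

theorem ExteriorAlgebra.map_map_apply {R A B C : Type*} [CommRing R] [AddCommGroup A] [Module R A]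
    [AddCommGroup B] [Module R B] [AddCommGroup C] [Module R C] (f : A →ₗ[R] B) (g : B →ₗ[R] C)
    (x : ExteriorAlgebra R A) :
    ExteriorAlgebra.map g (ExteriorAlgebra.map f x) = ExteriorAlgebra.map (g ∘ₗ f) x := by
  rw [← AlgHom.comp_apply, ExteriorAlgebra.map_comp_map]

section Pullback

variable {F : Type u} [Field F] {V U W : Symp.{u, v} F} {ψ : AddChar F ℂ}

/-- Pushing orientations into the exterior algebra of `V` avoids comparing elements of different
types; over a field nothing is lost, since this map is injective. -/
theorem OrientedLagrangian.ext_of_map_subtype {A B : OrientedLagrangian V} (hL : A.L = B.L)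
    (ho : ExteriorAlgebra.map A.L.subtype A.orientation =
      ExteriorAlgebra.map B.L.subtype B.orientation) : A = B := by
  obtain ⟨L, hA, a, ha, ha'⟩ := A
  obtain ⟨L', hB, b, hb, hb'⟩ := B
  dsimp only at hL ho
  subst hL
  obtain rfl : a = b := ExteriorAlgebra.map_injective_field L.ker_subtype ho
  rfl

theorem OrientedLagrangian.map_subtype_orientation (f : V ⟶ U) (A : OrientedLagrangian V) :
    ExteriorAlgebra.map (A.map f).L.subtype (A.map f).orientation =
      ExteriorAlgebra.map (Symp.equiv f).toLinearMap
        (ExteriorAlgebra.map A.L.subtype A.orientation) := by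
  exact (ExteriorAlgebra.map_map_apply ((Symp.equiv f).submoduleMap A.L).toLinearMap
    (A.L.map (Symp.equiv f : V.carrier →ₗ[F] U.carrier)).subtype _).trans
    (ExteriorAlgebra.map_map_apply A.L.subtype (Symp.equiv f).toLinearMap _).symm

theorem OrientedLagrangian.map_id (A : OrientedLagrangian V) : A.map (𝟙 V) = A := by
  refine ext_of_map_subtype (Submodule.map_id A.L) ?_
  rw [map_subtype_orientation]
  exact AlgHom.congr_fun (ExteriorAlgebra.map_id (M := V.carrier)) _

theorem OrientedLagrangian.map_comp (f : V ⟶ U) (g : U ⟶ W) (A : OrientedLagrangian V) :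
    A.map (f ≫ g) = (A.map f).map g := by
  refine ext_of_map_subtype
    (Submodule.map_comp (Symp.equiv f).toLinearMap (Symp.equiv g).toLinearMap A.L) ?_
  rw [map_subtype_orientation, map_subtype_orientation, map_subtype_orientation,
    ExteriorAlgebra.map_map_apply (Symp.equiv f).toLinearMap]
  rfl

theorem OrientedLagrangian.map_disjoint (f : V ⟶ U) {A B : OrientedLagrangian V}
    (h : A.L ⊓ B.L = ⊥) : (A.map f).L ⊓ (B.map f).L = ⊥ := by
  change A.L.map (Symp.equiv f : V.carrier →ₗ[F] U.carrier) ⊓ B.L.map _ = ⊥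
  rw [← Submodule.map_inf _ (Symp.equiv f).injective, h, Submodule.map_bot]

theorem totalSpace_apply_congr (w : totalSpace ψ V) {A B : OrientedLagrangian V} (h : A = B)
    (k : Heis V) : (w A).1 k = (w B).1 k := by
  rw [h]

theorem pullback_id : pullback ψ (𝟙 V) = LinearMap.id := by
  ext w L k
  exact totalSpace_apply_congr w L.map_id k

theorem pullback_comp (f : V ⟶ U) (g : U ⟶ W) :
    pullback ψ (f ≫ g) = pullback ψ f ∘ₗ pullback ψ g := by
  ext w L k
  exact totalSpace_apply_congr w (L.map_comp f g) _

/-- The pullback `𝓗_{f(L)} → 𝓗_L` along a symplectic isomorphism. -/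
noncomputable def modelPullback (ψ : AddChar F ℂ) (f : V ⟶ U) (L : OrientedLagrangian V)
    (v : modelSpace ψ (L.map f)) : modelSpace ψ L :=
  ⟨fun h => v.1 (Heis.map f h),
    fun z h => by simpa only [map_mul, Heis.map_ofCenter] using v.2.1 z (Heis.map f h),
    fun l hl h => by
      simpa only [map_mul, Heis.map_ofVec] using v.2.2 (Symp.equiv f l) ⟨l, hl, rfl⟩ (Heis.map f h)⟩

/-- `f` reindexes the sum over `M` as the sum over `f(M)` and preserves the normalization constant.
-/
theorem modelPullback_averaging [Fintype F] (f : V ⟶ U) (M L : OrientedLagrangian V)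
    (v : modelSpace ψ (L.map f)) :
    modelPullback ψ f M (averaging ψ (M.map f) (L.map f) v) =
      averaging ψ M L (modelPullback ψ f L v) := by
  ext k
  rw [averaging_apply]
  change (averaging ψ (M.map f) (L.map f) v).1 (Heis.map f k) = _
  rw [averaging_apply, normConst_map]
  refine congrArg (normConst ψ M L * ·) ?_
  refine (finsum_comp_equiv ((Symp.equiv f).submoduleMap M.L).toEquiv).symm.trans
    (finsum_congr fun m => ?_)
  change _ = v.1 (Heis.map f (Heis.ofVec (m : V.carrier) * k))
  rw [map_mul]
  rfl

/-- Each `F_{M°,L°}` factors into averagings through a common transversal `Z`, and `f(Z)` is one for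
the images, so compatibility with averaging suffices. -/
theorem pullback_mem_canonicalSpace [Fintype F] (hF : ringChar F ≠ 2) (hψ : ψ ≠ 1) (f : V ⟶ U)
    {w : totalSpace ψ U} (hw : w ∈ canonicalSpace ψ U) : pullback ψ f w ∈ canonicalSpace ψ V := by
  intro M L
  change canonicalSystem ψ V M L (modelPullback ψ f L (w (L.map f))) =
    modelPullback ψ f M (w (M.map f))
  obtain ⟨Z, hL, hM, -⟩ := OrientedLagrangian.exists_disjoint (Ring.two_ne_zero hF) L M M
  rw [(isCanonicalSystem_canonicalSystem hF hψ V).eq_averaging_comp hL hM, LinearMap.comp_apply,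
    ← modelPullback_averaging, ← modelPullback_averaging, ← LinearMap.comp_apply,
    ← (isCanonicalSystem_canonicalSystem hF hψ U).eq_averaging_comp
      (OrientedLagrangian.map_disjoint f hL) (OrientedLagrangian.map_disjoint f hM), hw]

end Pullback

/-! ### The functor and the Weil representation. -/

section WeilRepresentation

variable {F : Type u} [Field F] [Fintype F] {ψ : AddChar F ℂ}

/-- The contravariant functor `V ↦ 𝓗(V)`. -/
noncomputable def canonicalFunctor (hF : ringChar F ≠ 2) (hψ : ψ ≠ 1) :
    (Symp.{u, v} F)ᵒᵖ ⥤ FGModuleCat.{max u v} ℂ where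
  obj X :=
    have := canonicalSpace_finite hF hψ X.unop
    FGModuleCat.of ℂ (canonicalSpace ψ X.unop)
  map {X Y} f :=
    have := canonicalSpace_finite hF hψ X.unop
    have := canonicalSpace_finite hF hψ Y.unop
    FGModuleCat.ofHom ((pullback ψ f.unop).restrict
      fun _ hw => pullback_mem_canonicalSpace hF hψ f.unop hw)
  map_id X := by
    refine FGModuleCat.hom_ext (LinearMap.ext fun w => Subtype.ext ?_)
    exact (LinearMap.congr_fun pullback_id w.1)
  map_comp f g := by
    refine FGModuleCat.hom_ext (LinearMap.ext fun w => Subtype.ext ?_)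
    exact (LinearMap.congr_fun (pullback_comp g.unop f.unop) w.1)

/-- The action of `Sp(V)` on the canonical space, `ρ(g) = 𝓗(g⁻¹)`. -/
noncomputable def weilRep (hF : ringChar F ≠ 2) (hψ : ψ ≠ 1) (V : Symp.{u, v} F) :
    Representation ℂ (Aut V) (canonicalSpace ψ V) where
  toFun g := (pullback ψ g.inv).restrict fun _ hw => pullback_mem_canonicalSpace hF hψ g.inv hw
  map_one' := by
    ext1 w
    exact Subtype.ext (LinearMap.congr_fun pullback_id w.1)
  -- Multiplication in `Aut V` composes as functions do, so `(a * b).inv` is `a.inv ≫ b.inv`.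
  map_mul' a b := by
    ext1 w
    exact Subtype.ext (LinearMap.congr_fun (pullback_comp a.inv b.inv) w.1)

/-- The action of the Heisenberg group on the canonical space by right translations. -/
noncomputable def heisenbergRep (hF : ringChar F ≠ 2) (hψ : ψ ≠ 1) (V : Symp.{u, v} F) :
    Representation ℂ (Heis V) (canonicalSpace ψ V) where
  toFun h :=
    { toFun := fun w => ⟨fun L => modelRep ψ L h (w.1 L), fun M L => by
        rw [(isCanonicalSystem_canonicalSystem hF hψ V).intertwining, w.2 M L]⟩
      map_add' := fun _ _ => rfl
      map_smul' := fun _ _ => rfl }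
  map_one' := by
    ext1 w
    refine Subtype.ext (funext fun L => ?_)
    change modelRep ψ L 1 (w.1 L) = w.1 L
    rw [map_one, Module.End.one_apply]
  map_mul' a b := by
    ext1 w
    refine Subtype.ext (funext fun L => ?_)
    change modelRep ψ L (a * b) (w.1 L) = modelRep ψ L a (modelRep ψ L b (w.1 L))
    rw [map_mul, Module.End.mul_apply]

theorem heisenbergRep_isIrreducible (hF : ringChar F ≠ 2) (hψ : ψ ≠ 1) (V : Symp.{u, v} F) :
    Representation.IsIrreducible (V := canonicalSpace ψ V) (heisenbergRep hF hψ V) := by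
  obtain ⟨L⟩ := OrientedLagrangian.nonempty (Ring.two_ne_zero hF) V
  let e := canonicalSpaceEquiv hF hψ L
  have he : ∀ h w, e (heisenbergRep hF hψ V h w) = modelRep ψ L h (e w) := fun _ _ => rfl
  have hδ : modelDelta ψ L ≠ 0 := by
    intro h
    have h1 := modelDelta_apply_one (ψ := ψ) L
    rw [h] at h1
    exact zero_ne_one h1
  have hnt : Nontrivial (canonicalSpace ψ V) :=
    ⟨e.symm (modelDelta ψ L), 0, fun h => hδ (by simpa using h)⟩
  refine { exists_pair_ne := ⟨⊥, ⊤, fun h => ?_⟩, eq_bot_or_eq_top := fun σ => ?_ }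
  · exact bot_ne_top (congrArg Subrepresentation.toSubmodule h)
  · rw [or_iff_not_imp_left]
    intro hσ
    have hne : σ.toSubmodule.map e.toLinearMap ≠ ⊥ := by
      intro h
      exact hσ (Subrepresentation.toSubmodule_injective
        ((Submodule.map_eq_bot_iff (e := e)).mp h))
    have htop := modelSpace_irreducible hψ (Ring.two_ne_zero hF) _ (fun h f hf => by
      obtain ⟨w, hw, rfl⟩ := hf
      exact ⟨_, σ.apply_mem_toSubmodule h hw, he h w⟩) hne
    apply Subrepresentation.toSubmodule_injective
    refine Submodule.map_injective_of_injective e.injective (htop.trans ?_)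
    exact ((Submodule.map_top _).trans e.range).symm

theorem isWeilRepresentation_weilRep (hF : ringChar F ≠ 2) (hψ : ψ ≠ 1) (V : Symp.{u, v} F) :
    IsWeilRepresentation ψ V (W := canonicalSpace ψ V) (heisenbergRep hF hψ V) (weilRep hF hψ V) where
  irreducible := heisenbergRep_isIrreducible hF hψ V
  central z w := by
    refine Subtype.ext (funext fun L => ?_)
    ext k
    change (w.1 L).1 (k * Heis.ofCenter V z) = ψ z * (w.1 L).1 k
    rw [← (w.1 L).2.1 z k]
    refine congrArg (w.1 L).1 ?_
    ext
    · simp [Heis.ofCenter]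
    · simp [Heis.ofCenter, add_comm]
  compatible g h w := by
    refine Subtype.ext (funext fun L => ?_)
    ext k
    change (w.1 (L.map g.inv)).1 (Heis.map g.inv k * h) =
      (w.1 (L.map g.inv)).1 (Heis.map g.inv (k * Heis.map g.hom h))
    have h1 : Symp.equiv (g.hom ≫ g.inv) h.vec = h.vec := by
      rw [g.hom_inv_id]
      rfl
    have h2 : Heis.map g.inv (Heis.map g.hom h) = h := Heis.ext h1 rfl
    rw [map_mul, h2]

end WeilRepresentation

theorem proposition2 {F : Type u} [Field F] [Fintype F] (hF : ringChar F ≠ 2)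
    (ψ : AddChar F ℂ) (hψ : ψ ≠ 1) :
    (∀ V : Symp.{u, v} F, ∃! T : OperatorSystem ψ V, IsCanonicalSystem ψ V T) ∧
    ∃ (_ : ∀ V : Symp.{u, v} F, Module.Finite ℂ (canonicalSpace ψ V))
      (hmap : ∀ {V U : Symp.{u, v} F} (f : V ⟶ U),
        ∀ w ∈ canonicalSpace ψ U, pullback ψ f w ∈ canonicalSpace ψ V),
      (∃ (H : (Symp.{u, v} F)ᵒᵖ ⥤ FGModuleCat.{max u v} ℂ)
        (hobj : ∀ V : Symp.{u, v} F, H.obj (op V) = FGModuleCat.of ℂ (canonicalSpace ψ V)),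
        ∀ {V U : Symp.{u, v} F} (f : V ⟶ U),
          H.map f.op = eqToHom (hobj U) ≫
            FGModuleCat.ofHom ((pullback ψ f).restrict (hmap f)) ≫ eqToHom (hobj V).symm) ∧
      ∀ V : Symp.{u, v} F,
        ∃ (ρ : Representation ℂ (Aut V) (canonicalSpace ψ V))
          (π : Representation ℂ (Heis V) (canonicalSpace ψ V)),
          (∀ g : Aut V, ρ g = (pullback ψ g.inv).restrict (hmap g.inv)) ∧
          (∀ (h : Heis V) (w : canonicalSpace ψ V) (L : OrientedLagrangian V),
            (π h w).1 L = modelRep ψ L h (w.1 L)) ∧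
          IsWeilRepresentation ψ V (W := canonicalSpace ψ V) π ρ := by
  refine ⟨existsUnique_isCanonicalSystem hF hψ, canonicalSpace_finite hF hψ,
    fun f _ hw => pullback_mem_canonicalSpace hF hψ f hw,
    ⟨canonicalFunctor hF hψ, fun _ => rfl, fun f => ?_⟩, fun V =>
    ⟨weilRep hF hψ V, heisenbergRep hF hψ V, fun _ => rfl, fun _ _ _ => rfl,
      isWeilRepresentation_weilRep hF hψ V⟩⟩
  -- The object identifications hold by `rfl`, so both `eqToHom` factors are identities.
  exact ((Category.id_comp _).trans (Category.comp_id _)).symm
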